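/- Let $\mathbb F$ be a field of characteristic zero and let $\mathfrak L$ be a non-zero left Leibniz algebra over $\mathbb F$, i.e. an $\mathbb F$-vector space with a bilinear product satisfying $x(yz)=(xy)z+y(xz)$. Let $\mathrm{Leib}(\mathfrak L)$ be the linear span of all squares $x^2$, let $\mathfrak L_{\mathrm{Lie}}=\mathfrak L/\mathrm{Leib}(\mathfrak L)$ be the canonical Lie algebra, and assume that $\dim_{\mathbb F}\mathfrak L_{\mathrm{Lie}}<\infty$ and that $\mathfrak L$ is semi-simple, i.e. every solvable (two-sided) ideal of $\mathfrak L$ is contained in $\mathrm{Leib}(\mathfrak L)$. An $\mathfrak L$-bimodule is a vector space $M$ with bilinear left and right actions of $\mathfrak L$ satisfying $$(xy)\cdot m=x\cdot(y\cdot m)-y\cdot(x\cdot m),\quad (x\cdot m)\cdot y=x\cdot(m\cdot y)-m\cdot(xy),\quad (m\cdot x)\cdot y=m\cdot(xy)-x\cdot(m\cdot y).$$ For bimodules $M,N$ let $\mathfrak L$ act on $M\otimes N$ by $x\cdot(m\otimes n)=(x\cdot m)\otimes n+m\otimes(x\cdot n)$ and $(m\otimes n)\cdot x=(m\cdot x)\otimes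 n+m\otimes(n\cdot x)$, and let $M\,\overline\otimes\,N=(M\otimes N)/T(M,N)$, where $T(M,N)$ is the smallest subspace that is closed under both actions and contains all elements $$(x\cdot m+m\cdot x)\otimes(n\cdot y)+(m\cdot y)\otimes(x\cdot n+n\cdot x)\qquad(x,y\in\mathfrak L,\ m\in M,\ n\in N);$$ this is again an $\mathfrak L$-bimodule. Let $\mathrm{Gr}^{\mathrm{bi}}(\mathfrak L)$ be the free abelian group on the isomorphism classes of finite-dimensional irreducible $\mathfrak L$-bimodules, let the class of a finite-dimensional bimodule $X$ be $[X]=\sum_S[X:S][S]$, where $[X:S]$ is the multiplicity of the irreducible bimodule $S$ in a composition series of $X$, and let the biadditive multiplication of $\mathrm{Gr}^{\mathrm{bi}}(\mathfrak L)$ be determined by $[M]\cdot[N]=[M\,\overline\otimes\,N]$ for irreducible $M,N$. This is a commutative (not necessarily associative) ring. Then $\mathrm{Gr}^{\mathrm{bi}}(\mathfrak L)$ is neither alternative (i.e. it does not satisfy both $(uu)v=u(uv)$ and $(vu)u=v(uu)$ for all $u,v$) nor a Jordan ring (i.e. it does not satisfy $(u^2v)u=u^2(vu)$ for all $u,v$).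 -/

import Mathlib

open scoped TensorProduct

universe u v

namespace LeibnizAlg

/-! ### Left Leibniz algebras

An algebra over a field `F` is a (not necessarily associative or unital) ring `L` with an
`F`-module structure for which the multiplication is `F`-bilinear. -/

/-- `L` is a left Leibniz algebra: every left multiplication operator is a derivation. -/
class IsLeftLeibniz (L : Type u) [NonUnitalNonAssocRing L] : Prop where
  leibniz : ∀ x y z : L, x * (y * z) = (x * y) * z + y * (x * z)

section Algebra

variable (F : Type v) (L : Type u) [Field F] [NonUnitalNonAssocRing L] [Module F L]

/-- The Leibniz kernel: the linear span of all squares. -/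
def leibnizKernel : Submodule F L := Submodule.span F (Set.range fun x : L => x * x)

variable {F L}

/-- Two-sided ideals of the algebra `L`. -/
def IsIdeal (I : Submodule F L) : Prop :=
  ∀ x : L, ∀ y ∈ I, x * y ∈ I ∧ y * x ∈ I

/-- The derived series: `I⁽⁰⁾ = I`, and `I⁽ᵏ⁺¹⁾` is the span of all products `x y` with
`x, y ∈ I⁽ᵏ⁾`. -/
def derivedSeries (I : Submodule F L) : ℕ → Submodule F L
  | 0 => I
  | k + 1 => Submodule.span F
      {z : L | ∃ x ∈ derivedSeries I k, ∃ y ∈ derivedSeries I k, z = x * y}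

/-- Solvability of a subalgebra or ideal. -/
def IsSolvableSubspace (I : Submodule F L) : Prop := ∃ k : ℕ, derivedSeries I k = ⊥

variable (F L)

/-- A Leibniz algebra is semi-simple if its Leibniz kernel contains every solvable ideal. -/
def IsSemisimpleLeibniz : Prop :=
  ∀ I : Submodule F L, IsIdeal I → IsSolvableSubspace I → I ≤ leibnizKernel F L

/-- The underlying vector space of the canonical Lie algebra `L / Leib(L)`. -/
abbrev canonicalLie : Type u := L ⧸ leibnizKernel F L

end Algebra

/-! ### Bimodules -/

/-- A finite-dimensional weak `L`-bimodule: `left x m` is `x · m` and `right x m` is `m · x`.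
(Every finite-dimensional `F`-vector space has an isomorphic copy in the universe of `F`.) -/
structure WeakBimod (F : Type v) (L : Type u) [Field F] [NonUnitalNonAssocRing L]
    [Module F L] where
  carrier : Type v
  [addCommGroup : AddCommGroup carrier]
  [module : Module F carrier]
  [finiteDimensional : FiniteDimensional F carrier]
  left : L →ₗ[F] Module.End F carrier
  right : L →ₗ[F] Module.End F carrier
  /-- (LLM): `(xy)·m = x·(y·m) - y·(x·m)` -/
  llm : ∀ (x y : L) (m : carrier), left (x * y) m = left x (left y m) - left y (left x m)
  /-- (LML): `(x·m)·y = x·(m·y) - m·(xy)` -/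
  lml : ∀ (x y : L) (m : carrier), right y (left x m) = left x (right y m) - right (x * y) m

attribute [instance] WeakBimod.addCommGroup WeakBimod.module WeakBimod.finiteDimensional

/-- A finite-dimensional `L`-bimodule. -/
structure Bimod (F : Type v) (L : Type u) [Field F] [NonUnitalNonAssocRing L]
    [Module F L] extends WeakBimod F L where
  /-- (MLL): `(m·x)·y = m·(xy) - x·(m·y)` -/
  mll : ∀ (x y : L) (m : carrier), right y (right x m) = right (x * y) m - left x (right y m)

section Bimodules

variable {F : Type v} {L : Type u} [Field F] [NonUnitalNonAssocRing L] [Module F L]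

/-- Two bimodules are isomorphic if there is a linear equivalence compatible with both actions. -/
def BimodIso (X Y : WeakBimod F L) : Prop :=
  ∃ e : X.carrier ≃ₗ[F] Y.carrier,
    (∀ (x : L) (m : X.carrier), e (X.left x m) = Y.left x (e m)) ∧
    (∀ (x : L) (m : X.carrier), e (X.right x m) = Y.right x (e m))

theorem BimodIso.refl (X : WeakBimod F L) : BimodIso X X :=
  ⟨LinearEquiv.refl F _, fun _ _ => rfl, fun _ _ => rfl⟩

theorem BimodIso.symm {X Y : WeakBimod F L} : BimodIso X Y → BimodIso Y X := by
  rintro ⟨e, h1, h2⟩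
  refine ⟨e.symm, fun x m => ?_, fun x m => ?_⟩
  · rw [LinearEquiv.symm_apply_eq, h1, e.apply_symm_apply]
  · rw [LinearEquiv.symm_apply_eq, h2, e.apply_symm_apply]

theorem BimodIso.trans {X Y Z : WeakBimod F L} : BimodIso X Y → BimodIso Y Z → BimodIso X Z := by
  rintro ⟨e, h1, h2⟩ ⟨f, k1, k2⟩
  exact ⟨e.trans f, fun x m => by simp [h1, k1], fun x m => by simp [h2, k2]⟩

/-- Sub(bi)modules: subspaces closed under both actions. -/
@[ext]
structure Subbimod (X : WeakBimod F L) where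
  toSubmodule : Submodule F X.carrier
  left_mem : ∀ (x : L), ∀ m ∈ toSubmodule, X.left x m ∈ toSubmodule
  right_mem : ∀ (x : L), ∀ m ∈ toSubmodule, X.right x m ∈ toSubmodule

namespace Subbimod

variable {X : WeakBimod F L}

theorem toSubmodule_injective :
    Function.Injective (Subbimod.toSubmodule : Subbimod X → Submodule F X.carrier) :=
  fun _ _ h => Subbimod.ext h

instance : PartialOrder (Subbimod X) := PartialOrder.lift _ toSubmodule_injective

theorem le_def {A B : Subbimod X} : A ≤ B ↔ A.toSubmodule ≤ B.toSubmodule := Iff.rfl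

theorem lt_def {A B : Subbimod X} : A < B ↔ A.toSubmodule < B.toSubmodule := Iff.rfl

instance : Lattice (Subbimod X) where
  sup A B :=
    { toSubmodule := A.toSubmodule ⊔ B.toSubmodule
      left_mem := by
        intro x m hm
        obtain ⟨a, ha, b, hb, rfl⟩ := Submodule.mem_sup.1 hm
        rw [map_add]
        exact Submodule.add_mem_sup (A.left_mem x a ha) (B.left_mem x b hb)
      right_mem := by
        intro x m hm
        obtain ⟨a, ha, b, hb, rfl⟩ := Submodule.mem_sup.1 hm
        rw [map_add]
        exact Submodule.add_mem_sup (A.right_mem x a ha) (B.right_mem x b hb) }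
  inf A B :=
    { toSubmodule := A.toSubmodule ⊓ B.toSubmodule
      left_mem := fun x m hm => ⟨A.left_mem x m hm.1, B.left_mem x m hm.2⟩
      right_mem := fun x m hm => ⟨A.right_mem x m hm.1, B.right_mem x m hm.2⟩ }
  le_sup_left A B := (le_sup_left : A.toSubmodule ≤ A.toSubmodule ⊔ B.toSubmodule)
  le_sup_right A B := (le_sup_right : B.toSubmodule ≤ A.toSubmodule ⊔ B.toSubmodule)
  sup_le A B C h k := (sup_le h k : A.toSubmodule ⊔ B.toSubmodule ≤ C.toSubmodule)
  inf_le_left A B := (inf_le_left : A.toSubmodule ⊓ B.toSubmodule ≤ A.toSubmodule)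
  inf_le_right A B := (inf_le_right : A.toSubmodule ⊓ B.toSubmodule ≤ B.toSubmodule)
  le_inf A B C h k := (le_inf h k : A.toSubmodule ≤ B.toSubmodule ⊓ C.toSubmodule)

instance : BoundedOrder (Subbimod X) where
  top := ⟨⊤, fun _ _ _ => trivial, fun _ _ _ => trivial⟩
  le_top A := (le_top : A.toSubmodule ≤ ⊤)
  bot :=
    { toSubmodule := ⊥
      left_mem := by
        intro x m hm
        rw [Submodule.mem_bot] at hm ⊢
        rw [hm, map_zero]
      right_mem := by
        intro x m hm
        rw [Submodule.mem_bot] at hm ⊢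
        rw [hm, map_zero] }
  bot_le A := (bot_le : ⊥ ≤ A.toSubmodule)

theorem toSubmodule_sup (A B : Subbimod X) :
    (A ⊔ B).toSubmodule = A.toSubmodule ⊔ B.toSubmodule := rfl

theorem toSubmodule_inf (A B : Subbimod X) :
    (A ⊓ B).toSubmodule = A.toSubmodule ⊓ B.toSubmodule := rfl

theorem toSubmodule_bot : (⊥ : Subbimod X).toSubmodule = ⊥ := rfl

theorem toSubmodule_top : (⊤ : Subbimod X).toSubmodule = ⊤ := rfl

instance : IsModularLattice (Subbimod X) where
  sup_inf_le_assoc_of_le {A} B C h := by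
    rw [le_def]
    simp only [toSubmodule_sup, toSubmodule_inf]
    exact IsModularLattice.sup_inf_le_assoc_of_le (α := Submodule F X.carrier) B.toSubmodule h

instance : WellFoundedLT (Subbimod X) :=
  StrictMono.wellFoundedLT (f := (toSubmodule : Subbimod X → Submodule F X.carrier))
    fun _ _ h => h

instance : WellFoundedGT (Subbimod X) :=
  StrictMono.wellFoundedGT (f := (toSubmodule : Subbimod X → Submodule F X.carrier))
    fun _ _ h => h

/-- The smallest subspace containing `S` that is closed under both actions. -/
def generated (X : WeakBimod F L) (S : Set X.carrier) : Subbimod X where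
  toSubmodule := sInf {P : Submodule F X.carrier | S ⊆ P ∧
    (∀ x : L, ∀ m ∈ P, X.left x m ∈ P) ∧ (∀ x : L, ∀ m ∈ P, X.right x m ∈ P)}
  left_mem := by
    intro x m hm
    rw [Submodule.mem_sInf] at hm ⊢
    exact fun P hP => hP.2.1 x m (hm P hP)
  right_mem := by
    intro x m hm
    rw [Submodule.mem_sInf] at hm ⊢
    exact fun P hP => hP.2.2 x m (hm P hP)

theorem subset_generated (X : WeakBimod F L) (S : Set X.carrier) :
    S ⊆ (generated X S).toSubmodule := by
  intro m hm
  exact (Submodule.mem_sInf).2 fun P hP => hP.1 hm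

theorem generated_le {S : Set X.carrier} {A : Subbimod X} (h : S ⊆ A.toSubmodule) :
    generated X S ≤ A :=
  fun _ hm => Submodule.mem_sInf.1 hm A.toSubmodule ⟨h, A.left_mem, A.right_mem⟩

end Subbimod

/-- A subbimodule as a weak bimodule in its own right. -/
def WeakBimod.sub (X : WeakBimod F L) (A : Subbimod X) : WeakBimod F L where
  carrier := A.toSubmodule
  left :=
    { toFun := fun x => (X.left x).restrict (A.left_mem x)
      map_add' := fun x y => by ext m; simp
      map_smul' := fun c x => by ext m; simp }
  right :=
    { toFun := fun x => (X.right x).restrict (A.right_mem x)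
      map_add' := fun x y => by ext m; simp
      map_smul' := fun c x => by ext m; simp }
  llm := fun x y m => Subtype.ext (X.llm x y (A.toSubmodule.subtype m))
  lml := fun x y m => Subtype.ext (X.lml x y (A.toSubmodule.subtype m))

/-- The quotient of a weak bimodule by a subbimodule. -/
def WeakBimod.quot (X : WeakBimod F L) (A : Subbimod X) : WeakBimod F L where
  carrier := X.carrier ⧸ A.toSubmodule
  left :=
    { toFun := fun x => A.toSubmodule.mapQ A.toSubmodule (X.left x) (A.left_mem x)
      map_add' := fun x y => by ext m; simp
      map_smul' := fun c x => by ext m; simp }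
  right :=
    { toFun := fun x => A.toSubmodule.mapQ A.toSubmodule (X.right x) (A.right_mem x)
      map_add' := fun x y => by ext m; simp
      map_smul' := fun c x => by ext m; simp }
  llm := fun x y m => by
    obtain ⟨m, rfl⟩ := Submodule.Quotient.mk_surjective _ m
    exact congrArg (Submodule.Quotient.mk (p := A.toSubmodule)) (X.llm x y m)
  lml := fun x y m => by
    obtain ⟨m, rfl⟩ := Submodule.Quotient.mk_surjective _ m
    exact congrArg (Submodule.Quotient.mk (p := A.toSubmodule)) (X.lml x y m)

/-- A subbimodule of a bimodule as a bimodule. -/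
def Bimod.sub (X : Bimod F L) (A : Subbimod X.toWeakBimod) : Bimod F L where
  toWeakBimod := X.toWeakBimod.sub A
  mll := fun x y m => Subtype.ext (X.mll x y (A.toSubmodule.subtype m))

/-- The quotient of a bimodule by a subbimodule. -/
def Bimod.quot (X : Bimod F L) (A : Subbimod X.toWeakBimod) : Bimod F L where
  toWeakBimod := X.toWeakBimod.quot A
  mll := fun x y m => by
    obtain ⟨m, rfl⟩ := Submodule.Quotient.mk_surjective _ m
    exact congrArg (Submodule.Quotient.mk (p := A.toSubmodule)) (X.mll x y m)

/-- The intersection of `A` with `B`, as a subbimodule of `B`. -/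
def Subbimod.restrict {X : WeakBimod F L} (A B : Subbimod X) : Subbimod (X.sub B) where
  toSubmodule := A.toSubmodule.comap B.toSubmodule.subtype
  left_mem := fun x m hm => A.left_mem x (B.toSubmodule.subtype m) hm
  right_mem := fun x m hm => A.right_mem x (B.toSubmodule.subtype m) hm

/-- For subbimodules `A ≤ B` of `X`, the bimodule `B / A`. -/
def Bimod.factor (X : Bimod F L) (A B : Subbimod X.toWeakBimod) : Bimod F L :=
  (X.sub B).quot (A.restrict B)

/-- Irreducible bimodules: non-zero, and without subbimodules other than zero and the whole. -/
def Bimod.IsIrreducible (X : Bimod F L) : Prop :=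
  Nontrivial X.carrier ∧ ∀ A : Subbimod X.toWeakBimod, A = ⊥ ∨ A = ⊤

/-! ### The truncated tensor product -/

/-- Given families of operators `ρ` on `V` and `σ` on `W` indexed by `L`, the family
`x ↦ ρ(x) ⊗ id + id ⊗ σ(x)` on `V ⊗ W`. -/
noncomputable def tensorAction {V W : Type v} [AddCommGroup V] [Module F V] [AddCommGroup W]
    [Module F W] (ρ : L →ₗ[F] Module.End F V) (σ : L →ₗ[F] Module.End F W) :
    L →ₗ[F] Module.End F (V ⊗[F] W) :=
  (LinearMap.rTensorHom W).comp ρ + (LinearMap.lTensorHom V).comp σ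

theorem tensorAction_tmul {V W : Type v} [AddCommGroup V] [Module F V] [AddCommGroup W]
    [Module F W] (ρ : L →ₗ[F] Module.End F V) (σ : L →ₗ[F] Module.End F W) (x : L) (v : V)
    (w : W) : tensorAction ρ σ x (v ⊗ₜ[F] w) = ρ x v ⊗ₜ[F] w + v ⊗ₜ[F] σ x w := rfl

/-- The tensor product with `x·(m⊗n) = (x·m)⊗n + m⊗(x·n)` and `(m⊗n)·x = (m·x)⊗n + m⊗(n·x)`. -/
noncomputable def WeakBimod.tensor (M N : WeakBimod F L) : WeakBimod F L where
  carrier := M.carrier ⊗[F] N.carrier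
  left := tensorAction M.left N.left
  right := tensorAction M.right N.right
  llm := fun x y t => by
    induction t using TensorProduct.induction_on with
    | zero => simp only [map_zero, sub_zero]
    | add s t hs ht => simp only [map_add]; rw [hs, ht]; abel
    | tmul m n =>
      simp only [tensorAction_tmul, map_add, M.llm, N.llm, TensorProduct.sub_tmul,
        TensorProduct.tmul_sub]
      abel
  lml := fun x y t => by
    induction t using TensorProduct.induction_on with
    | zero => simp only [map_zero, sub_zero]
    | add s t hs ht => simp only [map_add]; rw [hs, ht]; abel
    | tmul m n =>
      simp only [tensorAction_tmul, map_add, M.lml, N.lml, TensorProduct.sub_tmul,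
        TensorProduct.tmul_sub]
      abel

theorem WeakBimod.tensor_left_tmul (M N : WeakBimod F L) (x : L) (m : M.carrier) (n : N.carrier) :
    (M.tensor N).left x (m ⊗ₜ[F] n) = M.left x m ⊗ₜ[F] n + m ⊗ₜ[F] N.left x n := rfl

theorem WeakBimod.tensor_right_tmul (M N : WeakBimod F L) (x : L) (m : M.carrier)
    (n : N.carrier) :
    (M.tensor N).right x (m ⊗ₜ[F] n) = M.right x m ⊗ₜ[F] n + m ⊗ₜ[F] N.right x n := rfl

/-- The set `S(M,N)` of all `(x·m + m·x) ⊗ (n·y) + (m·y) ⊗ (x·n + n·x)`. -/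
def truncSet (M N : WeakBimod F L) : Set (M.tensor N).carrier :=
  {t | ∃ (x y : L) (m : M.carrier) (n : N.carrier),
    t = (M.left x m + M.right x m) ⊗ₜ[F] N.right y n +
      M.right y m ⊗ₜ[F] (N.left x n + N.right x n)}

/-- `T(M,N)`, the weak subbimodule of `M ⊗ N` generated by `S(M,N)`. -/
noncomputable def truncSub (M N : WeakBimod F L) : Subbimod (M.tensor N) :=
  Subbimod.generated (M.tensor N) (truncSet M N)

/-- Relation (ZD). -/
theorem Bimod.zd (X : Bimod F L) (x y : L) (m : X.carrier) :
    X.right y (X.left x m) + X.right y (X.right x m) = 0 := by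
  rw [X.lml, X.mll]; abel

theorem Bimod.tensor_defect_mem (M N : Bimod F L) (x y : L)
    (t : M.carrier ⊗[F] N.carrier) :
    tensorAction M.right N.right y (tensorAction M.left N.left x t) +
      tensorAction M.right N.right y (tensorAction M.right N.right x t) ∈
      ((truncSub M.toWeakBimod N.toWeakBimod).toSubmodule :
        Submodule F (M.carrier ⊗[F] N.carrier)) := by
  induction t using TensorProduct.induction_on with
  | zero => simp only [map_zero, add_zero]; exact Submodule.zero_mem _
  | add s t hs ht =>
    have h := Submodule.add_mem _ hs ht
    simp only [map_add]
    rw [add_add_add_comm]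
    exact h
  | tmul m n =>
    refine Subbimod.subset_generated _ _ ⟨x, y, m, n, ?_⟩
    simp only [tensorAction_tmul, map_add, TensorProduct.add_tmul, TensorProduct.tmul_add]
    have h1 : M.right y (M.left x m) = - M.right y (M.right x m) :=
      eq_neg_of_add_eq_zero_left (M.zd x y m)
    have h2 : N.right y (N.left x n) = - N.right y (N.right x n) :=
      eq_neg_of_add_eq_zero_left (N.zd x y n)
    rw [h1, h2, TensorProduct.neg_tmul, TensorProduct.tmul_neg]
    abel

/-- The truncated tensor product `(M ⊗ N) / T(M,N)` of two bimodules. -/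
noncomputable def Bimod.truncTensor (M N : Bimod F L) : Bimod F L where
  toWeakBimod := (M.toWeakBimod.tensor N.toWeakBimod).quot
    (truncSub M.toWeakBimod N.toWeakBimod)
  mll := fun x y t => by
    obtain ⟨t, rfl⟩ := Submodule.Quotient.mk_surjective _ t
    refine (Submodule.Quotient.eq _).2 ?_
    have h := M.tensor_defect_mem N x y t
    have h2 : tensorAction M.right N.right y (tensorAction M.left N.left x t) =
        tensorAction M.left N.left x (tensorAction M.right N.right y t) -
          tensorAction M.right N.right (x * y) t :=
      (M.toWeakBimod.tensor N.toWeakBimod).lml x y t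
    rw [h2] at h
    have h3 : ∀ a b c : M.carrier ⊗[F] N.carrier, a - b + c = c - (b - a) := by
      intro a b c; abel
    rw [h3] at h
    exact h

/-! ### Composition series -/

/-- In a maximal chain of subbimodules consecutive quotients are irreducible. -/
theorem Bimod.factor_isIrreducible (X : Bimod F L) {A B : Subbimod X.toWeakBimod} (h : A ⋖ B) :
    (X.factor A B).IsIrreducible := by
  set p : Submodule F B.toSubmodule := A.toSubmodule.comap B.toSubmodule.subtype with hp
  constructor
  · refine Submodule.Quotient.nontrivial_iff.2 fun htop => h.lt.not_ge ?_
    intro m hm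
    have : (⟨m, hm⟩ : B.toSubmodule) ∈ p := by
      change p = ⊤ at htop
      rw [htop]; trivial
    exact this
  · intro C
    have key : ∀ (m : X.carrier) (hm : m ∈ B.toSubmodule),
        (p.mkQ ⟨m, hm⟩ ∈ C.toSubmodule) ↔ m ∈ ((C.toSubmodule.comap p.mkQ).map
          B.toSubmodule.subtype : Submodule F X.carrier) := by
      intro m hm
      rw [Submodule.mem_map]
      constructor
      · intro hC
        exact ⟨⟨m, hm⟩, hC, rfl⟩
      · rintro ⟨⟨m', hm'⟩, hC, rfl⟩
        exact hC
    let D : Subbimod X.toWeakBimod :=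
      { toSubmodule := (C.toSubmodule.comap p.mkQ).map B.toSubmodule.subtype
        left_mem := by
          rintro x m ⟨b, hb, rfl⟩
          exact ⟨⟨X.left x b, B.left_mem x b b.2⟩, C.left_mem x _ hb, rfl⟩
        right_mem := by
          rintro x m ⟨b, hb, rfl⟩
          exact ⟨⟨X.right x b, B.right_mem x b b.2⟩, C.right_mem x _ hb, rfl⟩ }
    have hDB : D ≤ B := by
      rintro m ⟨b, -, rfl⟩
      exact b.2
    have hAD : A ≤ D := by
      intro m hm
      have hmB : m ∈ B.toSubmodule := h.le hm
      refine (key m hmB).1 ?_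
      have h0 : p.mkQ ⟨m, hmB⟩ = 0 := (Submodule.Quotient.mk_eq_zero p).2 hm
      rw [h0]
      exact C.toSubmodule.zero_mem
    rcases h.eq_or_eq hAD hDB with hD | hD
    · left
      refine le_bot_iff.1 fun c hc => ?_
      obtain ⟨⟨m, hm⟩, rfl⟩ := Submodule.Quotient.mk_surjective p c
      have hmD : m ∈ D.toSubmodule := (key m hm).1 hc
      rw [hD] at hmD
      exact (Submodule.Quotient.mk_eq_zero p).2 hmD
    · right
      refine top_le_iff.1 fun c _ => ?_
      obtain ⟨⟨m, hm⟩, rfl⟩ := Submodule.Quotient.mk_surjective p c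
      refine (key m hm).2 ?_
      change m ∈ D.toSubmodule
      rw [hD]
      exact hm

/-- The second isomorphism theorem. -/
theorem Bimod.factor_sup_iso (X : Bimod F L) (A B : Subbimod X.toWeakBimod) :
    BimodIso (X.factor A (A ⊔ B)).toWeakBimod (X.factor (A ⊓ B) B).toWeakBimod := by
  refine BimodIso.symm ?_
  let p : Submodule F B.toSubmodule := (A ⊓ B).toSubmodule.comap B.toSubmodule.subtype
  let q : Submodule F (A ⊔ B).toSubmodule := A.toSubmodule.comap (A ⊔ B).toSubmodule.subtype
  let i : B.toSubmodule →ₗ[F] (A ⊔ B).toSubmodule :=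
    Submodule.inclusion (le_sup_right : B.toSubmodule ≤ A.toSubmodule ⊔ B.toSubmodule)
  have hpq : p ≤ q.comap i := fun b hb => hb.1
  let f : (B.toSubmodule ⧸ p) →ₗ[F] ((A ⊔ B).toSubmodule ⧸ q) := p.mapQ q i hpq
  have hinj : Function.Injective f := by
    rw [← LinearMap.ker_eq_bot, LinearMap.ker_eq_bot']
    intro c hc
    obtain ⟨b, rfl⟩ := Submodule.Quotient.mk_surjective p c
    have hb : i b ∈ q := (Submodule.Quotient.mk_eq_zero q).1 hc
    exact (Submodule.Quotient.mk_eq_zero p).2 ⟨hb, b.2⟩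
  have hsurj : Function.Surjective f := by
    intro c
    obtain ⟨⟨m, hm⟩, rfl⟩ := Submodule.Quotient.mk_surjective q c
    obtain ⟨a, ha, b, hb, rfl⟩ := Submodule.mem_sup.1 hm
    refine ⟨p.mkQ ⟨b, hb⟩, (Submodule.Quotient.eq q).2 ?_⟩
    change b - (a + b) ∈ A.toSubmodule
    rw [sub_add_cancel_right]
    exact A.toSubmodule.neg_mem ha
  refine ⟨LinearEquiv.ofBijective f ⟨hinj, hsurj⟩, fun x c => ?_, fun x c => ?_⟩
  · obtain ⟨b, rfl⟩ := Submodule.Quotient.mk_surjective p c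
    rfl
  · obtain ⟨b, rfl⟩ := Submodule.Quotient.mk_surjective p c
    rfl

variable (F L) in
/-- Isomorphism of irreducible bimodules. -/
def irrSetoid : Setoid {X : Bimod F L // X.IsIrreducible} where
  r X Y := BimodIso X.1.toWeakBimod Y.1.toWeakBimod
  iseqv := ⟨fun _ => BimodIso.refl _, fun h => h.symm, fun h k => h.trans k⟩

variable (F L) in
/-- The set of isomorphism classes of finite-dimensional irreducible bimodules. -/
def Irr : Type (max u (v + 1)) := Quotient (irrSetoid F L)

/-- The isomorphism class of an irreducible bimodule. -/
def Irr.mk (X : Bimod F L) (h : X.IsIrreducible) : Irr F L :=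
  Quotient.mk (irrSetoid F L) ⟨X, h⟩

theorem Irr.mk_eq_mk {X Y : Bimod F L} {hX : X.IsIrreducible} {hY : Y.IsIrreducible} :
    Irr.mk X hX = Irr.mk Y hY ↔ BimodIso X.toWeakBimod Y.toWeakBimod :=
  Quotient.eq (r := irrSetoid F L)

variable (F L) in
/-- The Grothendieck group `Gr^bi(L)`: the free abelian group on the isomorphism classes of
finite-dimensional irreducible bimodules. -/
def Gr : Type (max u (v + 1)) := Irr F L →₀ ℤ

noncomputable instance : AddCommGroup (Gr F L) := inferInstanceAs (AddCommGroup (Irr F L →₀ ℤ))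

/-- The basis element of an isomorphism class. -/
noncomputable def Gr.of (a : Irr F L) : Gr F L := Finsupp.single a 1

/-- The isomorphism class of the `i`-th factor of a composition series. -/
def Bimod.factorClass {X : Bimod F L} (s : CompositionSeries (Subbimod X.toWeakBimod))
    (i : Fin s.length) : Irr F L :=
  Irr.mk (X.factor (s i.castSucc) (s i.succ)) (X.factor_isIrreducible (s.step i))

/-- The sum of the classes of the factors of a series, that is `∑ [X : S] [S]` with `[X : S]` the
number of factors isomorphic to `S`. -/
noncomputable def Bimod.seriesClass {X : Bimod F L}
    (s : CompositionSeries (Subbimod X.toWeakBimod)) : Gr F L :=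
  ∑ i : Fin s.length, Gr.of (Bimod.factorClass s i)

theorem Bimod.exists_compositionSeries (X : Bimod F L) :
    ∃ s : CompositionSeries (Subbimod X.toWeakBimod), s.head = ⊥ ∧ s.last = ⊤ := by
  obtain ⟨f, f0, n, hn⟩ :=
    exists_covBy_seq_of_wellFoundedLT_wellFoundedGT (Subbimod X.toWeakBimod)
  exact ⟨⟨n, fun i => f i, fun i => hn.2 i i.2⟩, f0.eq_bot, hn.1.eq_top⟩

/-- The class `[X]` of a bimodule, computed from a composition series `0 = X₀ < ⋯ < Xₙ = X`. -/
noncomputable def Bimod.cls (X : Bimod F L) : Gr F L :=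
  Bimod.seriesClass X.exists_compositionSeries.choose

/-- The class does not depend on the composition series (Jordan–Hölder). -/
theorem Bimod.seriesClass_eq_cls {X : Bimod F L}
    (s : CompositionSeries (Subbimod X.toWeakBimod)) (h0 : s.head = ⊥) (h1 : s.last = ⊤) :
    Bimod.seriesClass s = X.cls := by
  have hs := X.exists_compositionSeries.choose_spec
  obtain ⟨e, he⟩ := CompositionSeries.jordan_holder s X.exists_compositionSeries.choose
    (h0.trans hs.1.symm) (h1.trans hs.2.symm)
  refine Fintype.sum_equiv e _ _ fun i => congrArg Gr.of (Irr.mk_eq_mk.2 ?_)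
  exact JordanHolderLattice.Iso.rel
    (fun a b => BimodIso (X.factor a.1 a.2).toWeakBimod (X.factor b.1 b.2).toWeakBimod)
    (BimodIso.refl _) (fun h => h.symm) (fun h k => h.trans k)
    (fun _ => X.factor_sup_iso _ _) (he i)

/-- An isomorphism carries subbimodules to subbimodules. -/
def Subbimod.congr {X Y : WeakBimod F L} (e : X.carrier ≃ₗ[F] Y.carrier)
    (hl : ∀ (x : L) (m : X.carrier), e (X.left x m) = Y.left x (e m))
    (hr : ∀ (x : L) (m : X.carrier), e (X.right x m) = Y.right x (e m)) :
    Subbimod X ≃o Subbimod Y where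
  toFun A :=
    { toSubmodule := A.toSubmodule.map (e : X.carrier →ₗ[F] Y.carrier)
      left_mem := by
        rintro x _ ⟨m, hm, rfl⟩
        exact ⟨X.left x m, A.left_mem x m hm, hl x m⟩
      right_mem := by
        rintro x _ ⟨m, hm, rfl⟩
        exact ⟨X.right x m, A.right_mem x m hm, hr x m⟩ }
  invFun B :=
    { toSubmodule := B.toSubmodule.comap (e : X.carrier →ₗ[F] Y.carrier)
      left_mem := by
        intro x m hm
        change e (X.left x m) ∈ B.toSubmodule
        rw [hl]
        exact B.left_mem x _ hm
      right_mem := by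
        intro x m hm
        change e (X.right x m) ∈ B.toSubmodule
        rw [hr]
        exact B.right_mem x _ hm }
  left_inv A := Subbimod.ext (Submodule.comap_map_eq_of_injective e.injective _)
  right_inv B := Subbimod.ext (Submodule.map_comap_eq_of_surjective e.surjective _)
  map_rel_iff' := Submodule.map_le_map_iff_of_injective e.injective _ _

/-- Isomorphic bimodules have the same class. -/
theorem Bimod.cls_congr {X Y : Bimod F L} (h : BimodIso X.toWeakBimod Y.toWeakBimod) :
    X.cls = Y.cls := by
  obtain ⟨e, hl, hr⟩ := h
  obtain ⟨s, h0, h1⟩ := X.exists_compositionSeries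
  let o := Subbimod.congr e hl hr
  let t : CompositionSeries (Subbimod Y.toWeakBimod) :=
    ⟨s.length, fun i => o (s i), fun i => (apply_covBy_apply_iff o).2 (s.step i)⟩
  have t0 : t.head = ⊥ := (congrArg o h0).trans (map_bot o)
  have t1 : t.last = ⊤ := (congrArg o h1).trans (map_top o)
  rw [← Bimod.seriesClass_eq_cls s h0 h1, ← Bimod.seriesClass_eq_cls t t0 t1]
  refine Fintype.sum_congr _ _ fun i => congrArg Gr.of (Irr.mk_eq_mk.2 ?_)
  let A := s i.castSucc
  let B := s i.succ
  let p : Submodule F B.toSubmodule := A.toSubmodule.comap B.toSubmodule.subtype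
  let q : Submodule F (o B).toSubmodule := (o A).toSubmodule.comap (o B).toSubmodule.subtype
  let eB : B.toSubmodule ≃ₗ[F] (o B).toSubmodule := e.submoduleMap B.toSubmodule
  have hpq : p.map (eB : B.toSubmodule →ₗ[F] (o B).toSubmodule) = q := by
    ext ⟨m, hm⟩
    constructor
    · rintro ⟨b, hb, hbm⟩
      exact ⟨b, hb, congrArg Subtype.val hbm⟩
    · rintro ⟨a, ha, ham⟩
      obtain ⟨b, hb, hbm⟩ := hm
      have hab : a = b := e.injective (ham.trans hbm.symm)
      subst hab
      exact ⟨⟨a, hb⟩, ha, Subtype.ext ham⟩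
  refine ⟨Submodule.Quotient.equiv p q eB hpq, fun x c => ?_, fun x c => ?_⟩
  · obtain ⟨b, rfl⟩ := Submodule.Quotient.mk_surjective p c
    exact congrArg q.mkQ (Subtype.ext (hl x b))
  · obtain ⟨b, rfl⟩ := Submodule.Quotient.mk_surjective p c
    exact congrArg q.mkQ (Subtype.ext (hr x b))

/-! ### The Grothendieck ring -/

/-- A linear equivalence compatible with the actions and carrying one subbimodule onto another
induces an isomorphism of quotients. -/
theorem BimodIso.quot {X Y : WeakBimod F L} (A : Subbimod X) (B : Subbimod Y)
    (e : X.carrier ≃ₗ[F] Y.carrier)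
    (hl : ∀ (x : L) (m : X.carrier), e (X.left x m) = Y.left x (e m))
    (hr : ∀ (x : L) (m : X.carrier), e (X.right x m) = Y.right x (e m))
    (h : A.toSubmodule.map (e : X.carrier →ₗ[F] Y.carrier) = B.toSubmodule) :
    BimodIso (X.quot A) (Y.quot B) := by
  refine ⟨Submodule.Quotient.equiv A.toSubmodule B.toSubmodule e h, fun x c => ?_, fun x c => ?_⟩
  · obtain ⟨b, rfl⟩ := Submodule.Quotient.mk_surjective _ c
    exact congrArg B.toSubmodule.mkQ (hl x b)
  · obtain ⟨b, rfl⟩ := Submodule.Quotient.mk_surjective _ c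
    exact congrArg B.toSubmodule.mkQ (hr x b)

theorem Subbimod.map_generated {X Y : WeakBimod F L} (e : X.carrier ≃ₗ[F] Y.carrier)
    (hl : ∀ (x : L) (m : X.carrier), e (X.left x m) = Y.left x (e m))
    (hr : ∀ (x : L) (m : X.carrier), e (X.right x m) = Y.right x (e m))
    (S : Set X.carrier) (T : Set Y.carrier) (hST : ∀ m ∈ S, e m ∈ T)
    (hTS : ∀ m ∈ T, e.symm m ∈ S) :
    (generated X S).toSubmodule.map (e : X.carrier →ₗ[F] Y.carrier) =
      (generated Y T).toSubmodule := by
  refine congrArg Subbimod.toSubmodule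
    (le_antisymm ?_ ?_ : Subbimod.congr e hl hr (generated X S) = generated Y T)
  · rw [← OrderIso.le_symm_apply]
    exact generated_le fun m hm => subset_generated Y T (hST m hm)
  · refine generated_le fun m hm => ?_
    exact ⟨e.symm m, subset_generated X S (hTS m hm), e.apply_symm_apply m⟩

theorem Bimod.truncTensor_congr {M M' N N' : Bimod F L}
    (h : BimodIso M.toWeakBimod M'.toWeakBimod) (k : BimodIso N.toWeakBimod N'.toWeakBimod) :
    BimodIso (M.truncTensor N).toWeakBimod (M'.truncTensor N').toWeakBimod := by
  obtain ⟨e, el, er⟩ := h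
  obtain ⟨f, fl, fr⟩ := k
  let g : M.carrier ⊗[F] N.carrier ≃ₗ[F] M'.carrier ⊗[F] N'.carrier := TensorProduct.congr e f
  have hl : ∀ (x : L) (t : M.carrier ⊗[F] N.carrier),
      g (tensorAction M.left N.left x t) = tensorAction M'.left N'.left x (g t) := by
    intro x t
    induction t using TensorProduct.induction_on with
    | zero => simp only [map_zero]
    | add s t hs ht => simp only [map_add, hs, ht]
    | tmul m n => simp only [g, tensorAction_tmul, map_add, TensorProduct.congr_tmul, el, fl]
  have hr : ∀ (x : L) (t : M.carrier ⊗[F] N.carrier),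
      g (tensorAction M.right N.right x t) = tensorAction M'.right N'.right x (g t) := by
    intro x t
    induction t using TensorProduct.induction_on with
    | zero => simp only [map_zero]
    | add s t hs ht => simp only [map_add, hs, ht]
    | tmul m n => simp only [g, tensorAction_tmul, map_add, TensorProduct.congr_tmul, er, fr]
  refine BimodIso.quot _ _ g hl hr (Subbimod.map_generated
    (X := M.toWeakBimod.tensor N.toWeakBimod) (Y := M'.toWeakBimod.tensor N'.toWeakBimod)
    g hl hr (truncSet _ _) (truncSet _ _) ?_ ?_)
  · rintro _ ⟨x, y, m, n, rfl⟩
    refine ⟨x, y, e m, f n, ?_⟩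
    refine (map_add g _ _).trans ?_
    simp only [g, TensorProduct.congr_tmul, map_add, el, er, fl, fr]
  · rintro _ ⟨x, y, m, n, rfl⟩
    have el' : ∀ x m, e.symm (M'.left x m) = M.left x (e.symm m) := fun x m => by
      rw [LinearEquiv.symm_apply_eq, el, e.apply_symm_apply]
    have er' : ∀ x m, e.symm (M'.right x m) = M.right x (e.symm m) := fun x m => by
      rw [LinearEquiv.symm_apply_eq, er, e.apply_symm_apply]
    have fl' : ∀ x m, f.symm (N'.left x m) = N.left x (f.symm m) := fun x m => by
      rw [LinearEquiv.symm_apply_eq, fl, f.apply_symm_apply]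
    have fr' : ∀ x m, f.symm (N'.right x m) = N.right x (f.symm m) := fun x m => by
      rw [LinearEquiv.symm_apply_eq, fr, f.apply_symm_apply]
    refine ⟨x, y, e.symm m, f.symm n, ?_⟩
    refine (map_add g.symm _ _).trans ?_
    simp only [g, TensorProduct.congr_symm_tmul, map_add, el', er', fl', fr']

theorem Bimod.truncTensor_comm (M N : Bimod F L) :
    BimodIso (M.truncTensor N).toWeakBimod (N.truncTensor M).toWeakBimod := by
  let g : M.carrier ⊗[F] N.carrier ≃ₗ[F] N.carrier ⊗[F] M.carrier := TensorProduct.comm F _ _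
  have hl : ∀ (x : L) (t : M.carrier ⊗[F] N.carrier),
      g (tensorAction M.left N.left x t) = tensorAction N.left M.left x (g t) := by
    intro x t
    induction t using TensorProduct.induction_on with
    | zero => simp only [map_zero]
    | add s t hs ht => simp only [map_add, hs, ht]
    | tmul m n =>
      simp only [g, tensorAction_tmul, map_add, TensorProduct.comm_tmul]
      exact add_comm _ _
  have hr : ∀ (x : L) (t : M.carrier ⊗[F] N.carrier),
      g (tensorAction M.right N.right x t) = tensorAction N.right M.right x (g t) := by
    intro x t
    induction t using TensorProduct.induction_on with
    | zero => simp only [map_zero]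
    | add s t hs ht => simp only [map_add, hs, ht]
    | tmul m n =>
      simp only [g, tensorAction_tmul, map_add, TensorProduct.comm_tmul]
      exact add_comm _ _
  refine BimodIso.quot _ _ g hl hr (Subbimod.map_generated
    (X := M.toWeakBimod.tensor N.toWeakBimod) (Y := N.toWeakBimod.tensor M.toWeakBimod)
    g hl hr (truncSet _ _) (truncSet _ _) ?_ ?_)
  · rintro _ ⟨x, y, m, n, rfl⟩
    refine ⟨x, y, n, m, ?_⟩
    refine (map_add g _ _).trans ?_
    simp only [g, TensorProduct.comm_tmul]
    exact add_comm _ _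
  · rintro _ ⟨x, y, m, n, rfl⟩
    refine ⟨x, y, n, m, ?_⟩
    refine (map_add g.symm _ _).trans ?_
    simp only [g, TensorProduct.comm_symm_tmul]
    exact add_comm _ _

/-- The product of two basis elements: `[M] · [N]` is the class of the truncated tensor product
of `M` and `N`. -/
noncomputable def Irr.mul (a b : Irr F L) : Gr F L :=
  Quotient.liftOn₂ a b (fun M N => (M.1.truncTensor N.1).cls) fun _ _ _ _ h k =>
    Bimod.cls_congr (Bimod.truncTensor_congr h k)

theorem Irr.mk_mul_mk (M N : Bimod F L) (hM : M.IsIrreducible) (hN : N.IsIrreducible) :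
    Irr.mul (Irr.mk M hM) (Irr.mk N hN) = (M.truncTensor N).cls := rfl

theorem Irr.mul_comm (a b : Irr F L) : Irr.mul a b = Irr.mul b a := by
  induction a using Quotient.inductionOn with
  | h M =>
    induction b using Quotient.inductionOn with
    | h N => exact Bimod.cls_congr (Bimod.truncTensor_comm M.1 N.1)

/-- The biadditive extension of the product of basis elements. -/
noncomputable instance : Mul (Gr F L) where
  mul f g := Finsupp.sum (M := ℤ) f fun a m => Finsupp.sum (M := ℤ) g fun b n =>
    (m * n) • Irr.mul a b

theorem Gr.mul_def (f g : Gr F L) :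
    f * g = Finsupp.sum (M := ℤ) f fun a m => Finsupp.sum (M := ℤ) g fun b n =>
      (m * n) • Irr.mul a b := rfl

theorem Gr.mul_comm' (f g : Gr F L) : f * g = g * f := by
  rw [Gr.mul_def, Gr.mul_def]
  refine (Finsupp.sum_comm (M := ℤ) (M' := ℤ) f g _).trans ?_
  refine Finsupp.sum_congr fun b _ => Finsupp.sum_congr fun a _ => ?_
  rw [Irr.mul_comm, mul_comm]

theorem Gr.left_distrib' (f g h : Gr F L) : f * (g + h) = f * g + f * h := by
  simp only [Gr.mul_def]
  refine Eq.trans ?_ (Finset.sum_add_distrib (M := Gr F L))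
  refine Finset.sum_congr rfl fun a _ => ?_
  refine Finsupp.sum_add_index' (M := ℤ) (fun b => ?_) fun b m n => ?_
  · rw [mul_zero, zero_smul]
  · rw [mul_add, add_smul]

/-- The Grothendieck ring `Gr^bi(L)`. -/
noncomputable instance : NonUnitalNonAssocCommRing (Gr F L) where
  left_distrib := Gr.left_distrib'
  right_distrib f g h := by
    rw [Gr.mul_comm', Gr.left_distrib', Gr.mul_comm' h f, Gr.mul_comm' h g]
  zero_mul _ := Finsupp.sum_zero_index (M := ℤ)
  mul_zero f := by
    rw [Gr.mul_comm']
    exact Finsupp.sum_zero_index (M := ℤ)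
  mul_comm := Gr.mul_comm'

theorem Gr.of_mul_of (a b : Irr F L) : Gr.of a * Gr.of b = Irr.mul a b := by
  rw [Gr.mul_def, Gr.of, Gr.of, Finsupp.sum_single_index, Finsupp.sum_single_index] <;> simp

end Bimodules

/-! ### Associativity properties -/

/-- Alternative rings: left and right alternative. -/
def IsAlternative (R : Type*) [NonUnitalNonAssocRing R] : Prop :=
  (∀ x y : R, (x * x) * y = x * (x * y)) ∧ ∀ x y : R, (y * x) * x = y * (x * x)

end LeibnizAlg

/-! Symmetric and anti-symmetric bimodules hardly interact under the truncated tensor product. If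
both factors are symmetric, or both anti-symmetric, nothing is truncated and the product is of the
same type; if one factor is symmetric and the other anti-symmetric, both irreducible with non-zero
left action, everything is truncated and the product is 0 (`Bimod.truncTensor_subsingleton`). The
trivial bimodule is of both types, and its class e is the identity of the ring. This one overlap
breaks the ring identities.

Let V be a minimal ideal of the canonical Lie algebra with the adjoint action, and let s and a be
the classes of V made into a symmetric and an anti-symmetric bimodule. Then s² = k e + P and a² = l
e + Q, where P and Q contain only non-trivial symmetric, respectively anti-symmetric, classes. Since
the trivial radical excludes solvable minimal ideals, Cartan's criterion in characteristic zero
makes the Killing form non-zero on V, and the form is a non-zero homomorphism from V ⊗ V to the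
trivial module, so k, l > 0. The bracket is a non-zero homomorphism from V ⊗ V to V, so s occurs in
P and P ≠ 0 (`Bimod.coeff_cls_truncTensor_pos`).

Now sa = Pa = PQ = 0. Hence (ss)a = k a ≠ 0 although s(sa) = 0, so the ring is not alternative. The
Jordan identity for a + s and a − s, with a as second variable, gives 2 a²s² = 2 a(a s²). But a²s² =
k a² + l P and a(a s²) = k a², so 2l P = 0, which is impossible in a free abelian group. The algebra
is isolated in `not_isAlternative_and_not_isCommJordan_of_module`, which asks only for a module with
such a form and such a product. -/

namespace LeibnizAlg

/-! ### Constituents and multiplicities in the Grothendieck group -/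

section Classes

variable {F : Type v} {L : Type u} [Field F] [NonUnitalNonAssocRing L] [Module F L]

/-- The multiplicity of a basis element. -/
noncomputable def Gr.coeff (c : Irr F L) : Gr F L →+ ℤ := Finsupp.applyAddHom (M := ℤ) c

theorem Gr.ext_coeff {f g : Gr F L} (h : ∀ c, Gr.coeff c f = Gr.coeff c g) : f = g :=
  Finsupp.ext h

theorem Gr.coeff_of_self (c : Irr F L) : Gr.coeff c (Gr.of c) = 1 :=
  Finsupp.single_eq_same

theorem Gr.coeff_of_ne {c d : Irr F L} (h : d ≠ c) : Gr.coeff d (Gr.of c) = 0 :=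
  Finsupp.single_eq_of_ne h

theorem Gr.coeff_of_nonneg (c d : Irr F L) : 0 ≤ Gr.coeff d (Gr.of c) := by
  by_cases h : d = c
  · rw [h, Gr.coeff_of_self]; exact zero_le_one
  · rw [Gr.coeff_of_ne h]

theorem Gr.of_ne_zero (c : Irr F L) : Gr.of c ≠ 0 := fun h => by
  have := Gr.coeff_of_self c
  rw [h, map_zero] at this
  exact zero_ne_one this

theorem Gr.eq_zero_of_zsmul_eq_zero {n : ℤ} (hn : n ≠ 0) {f : Gr F L} (h : n • f = 0) :
    f = 0 := by
  refine Gr.ext_coeff fun c => ?_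
  have := congrArg (Gr.coeff c) h
  rw [map_zsmul, map_zero, smul_eq_mul] at this
  rw [map_zero]
  exact (mul_eq_zero.1 this).resolve_left hn

/-- Elements all of whose basis constituents annihilate each other have product zero. -/
theorem Gr.mul_eq_zero_of_forall {f g : Gr F L}
    (h : ∀ a b, Gr.coeff a f ≠ 0 → Gr.coeff b g ≠ 0 → Irr.mul a b = 0) : f * g = 0 := by
  rw [Gr.mul_def]
  refine Finset.sum_eq_zero fun a ha => Finset.sum_eq_zero fun b hb => ?_
  exact (congrArg _ (h a b (Finsupp.mem_support_iff.1 ha) (Finsupp.mem_support_iff.1 hb))).trans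
    (smul_zero _)

/-- A basis element acting as the identity on basis elements is an identity. -/
theorem Gr.of_mul_of_forall {e : Irr F L} (h : ∀ c, Irr.mul e c = Gr.of c) (f : Gr F L) :
    Gr.of e * f = f := by
  rw [Gr.mul_def, Gr.of]
  refine (Finsupp.sum_single_index ?_).trans ?_
  · simp only [zero_mul, zero_smul]
    exact Finsupp.sum_fun_zero (N := Gr F L) (M := ℤ) f
  · refine Eq.trans ?_ (Finsupp.sum_single (M := ℤ) f)
    refine Finsupp.sum_congr fun c _ => ?_
    rw [one_mul, h, Gr.of]
    exact (Finsupp.smul_single' _ _ _).trans (by rw [mul_one])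

/-- Jordan–Hölder allows any composition series to be used, and the constituent is one of its
factors. This passes properties inherited by subquotients from a bimodule to the constituents of its
class. -/
theorem Bimod.exists_factor_of_coeff_cls_ne_zero {X : Bimod F L} {c : Irr F L}
    (h : Gr.coeff c X.cls ≠ 0) :
    ∃ (A B : Subbimod X.toWeakBimod) (hAB : A ⋖ B),
      c = Irr.mk (X.factor A B) (X.factor_isIrreducible hAB) := by
  obtain ⟨s, h0, h1⟩ := X.exists_compositionSeries
  rw [← Bimod.seriesClass_eq_cls s h0 h1, Bimod.seriesClass, map_sum] at h
  obtain ⟨i, -, hi⟩ := Finset.exists_ne_zero_of_sum_ne_zero h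
  refine ⟨s i.castSucc, s i.succ, s.step i, ?_⟩
  by_contra hc
  exact hi (Gr.coeff_of_ne hc)

theorem Bimod.cls_eq_zero_of_subsingleton {X : Bimod F L} (h : Subsingleton X.carrier) :
    X.cls = 0 := by
  refine Gr.ext_coeff fun c => ?_
  rw [map_zero]
  by_contra hc
  obtain ⟨A, B, hAB, -⟩ := Bimod.exists_factor_of_coeff_cls_ne_zero hc
  exact hAB.lt.ne (Subbimod.ext (Subsingleton.elim (α := Submodule F X.carrier) _ _))

/-- The quotient of `X` by the kernel of a surjective homomorphism. -/
theorem Bimod.factor_top_iso {X Y : Bimod F L} (φ : X.carrier →ₗ[F] Y.carrier)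
    (hφ : Function.Surjective φ)
    (hl : ∀ (x : L) (m : X.carrier), φ (X.left x m) = Y.left x (φ m))
    (hr : ∀ (x : L) (m : X.carrier), φ (X.right x m) = Y.right x (φ m))
    (K : Subbimod X.toWeakBimod) (hK : K.toSubmodule = LinearMap.ker φ) :
    BimodIso (X.factor K ⊤).toWeakBimod Y.toWeakBimod := by
  let p : Submodule F (⊤ : Subbimod X.toWeakBimod).toSubmodule :=
    K.toSubmodule.comap (⊤ : Subbimod X.toWeakBimod).toSubmodule.subtype
  let ψ : (⊤ : Subbimod X.toWeakBimod).toSubmodule →ₗ[F] Y.carrier :=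
    φ.comp (⊤ : Subbimod X.toWeakBimod).toSubmodule.subtype
  have hp : p = LinearMap.ker ψ := by
    ext m
    change (m : X.carrier) ∈ K.toSubmodule ↔ φ m = 0
    rw [hK, LinearMap.mem_ker]
  have hψ : Function.Surjective ψ := fun y => by
    obtain ⟨m, rfl⟩ := hφ y
    exact ⟨⟨m, trivial⟩, rfl⟩
  refine ⟨(Submodule.quotEquivOfEq p _ hp).trans (ψ.quotKerEquivOfSurjective hψ),
    fun x c => ?_, fun x c => ?_⟩
  · obtain ⟨b, rfl⟩ := Submodule.Quotient.mk_surjective p c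
    exact hl x b
  · obtain ⟨b, rfl⟩ := Submodule.Quotient.mk_surjective p c
    exact hr x b

/-- The kernel of a homomorphism. -/
def Subbimod.ker {X Y : WeakBimod F L} (φ : X.carrier →ₗ[F] Y.carrier)
    (hl : ∀ (x : L) (m : X.carrier), φ (X.left x m) = Y.left x (φ m))
    (hr : ∀ (x : L) (m : X.carrier), φ (X.right x m) = Y.right x (φ m)) : Subbimod X where
  toSubmodule := LinearMap.ker φ
  left_mem x m hm := by
    rw [LinearMap.mem_ker] at hm ⊢
    rw [hl, hm, map_zero]
  right_mem x m hm := by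
    rw [LinearMap.mem_ker] at hm ⊢
    rw [hr, hm, map_zero]

/-- The image of a homomorphism. -/
def Subbimod.range {X Y : WeakBimod F L} (φ : X.carrier →ₗ[F] Y.carrier)
    (hl : ∀ (x : L) (m : X.carrier), φ (X.left x m) = Y.left x (φ m))
    (hr : ∀ (x : L) (m : X.carrier), φ (X.right x m) = Y.right x (φ m)) : Subbimod Y where
  toSubmodule := LinearMap.range φ
  left_mem x := by
    rintro _ ⟨m, rfl⟩
    exact ⟨X.left x m, hl x m⟩
  right_mem x := by
    rintro _ ⟨m, rfl⟩
    exact ⟨X.right x m, hr x m⟩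

theorem Bimod.surjective_of_isIrreducible {X Y : Bimod F L} (hY : Y.IsIrreducible)
    (φ : X.carrier →ₗ[F] Y.carrier) (hφ : φ ≠ 0)
    (hl : ∀ (x : L) (m : X.carrier), φ (X.left x m) = Y.left x (φ m))
    (hr : ∀ (x : L) (m : X.carrier), φ (X.right x m) = Y.right x (φ m)) :
    Function.Surjective φ := by
  rw [← LinearMap.range_eq_top]
  rcases hY.2 (Subbimod.range φ hl hr) with h | h
  · exact absurd (LinearMap.range_eq_bot.1 (congrArg Subbimod.toSubmodule h)) hφ
  · exact congrArg Subbimod.toSubmodule h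

/-- The correspondence theorem: a subbimodule above the kernel is determined by its image, which is
zero or everything. -/
theorem Bimod.ker_covBy_top {X Y : Bimod F L} (hY : Y.IsIrreducible)
    (φ : X.carrier →ₗ[F] Y.carrier) (hφ : φ ≠ 0)
    (hl : ∀ (x : L) (m : X.carrier), φ (X.left x m) = Y.left x (φ m))
    (hr : ∀ (x : L) (m : X.carrier), φ (X.right x m) = Y.right x (φ m)) :
    Subbimod.ker φ hl hr ⋖ ⊤ := by
  refine ⟨lt_top_iff_ne_top.2 fun h => hφ ?_, fun C hC hC' => ?_⟩
  · exact LinearMap.ker_eq_top.1 (congrArg Subbimod.toSubmodule h)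
  · let D : Subbimod Y.toWeakBimod :=
      { toSubmodule := C.toSubmodule.map φ
        left_mem := by
          rintro x _ ⟨m, hm, rfl⟩
          exact ⟨X.left x m, C.left_mem x m hm, hl x m⟩
        right_mem := by
          rintro x _ ⟨m, hm, rfl⟩
          exact ⟨X.right x m, C.right_mem x m hm, hr x m⟩ }
    rcases hY.2 D with h | h
    · refine hC.not_ge fun m hm => ?_
      have : φ m ∈ D.toSubmodule := ⟨m, hm, rfl⟩
      rw [h] at this
      exact this
    · refine hC'.not_ge fun m _ => ?_
      have : φ m ∈ D.toSubmodule := by rw [h]; trivial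
      obtain ⟨c, hc, hcm⟩ := this
      have hmc : m - c ∈ C.toSubmodule := hC.le (by
        change φ (m - c) = 0
        rw [map_sub, hcm, sub_self])
      have := C.toSubmodule.add_mem hmc hc
      rwa [sub_add_cancel] at this

/-- A composition series from 0 to K is prolonged by one step to the whole bimodule. Later only the
non-negativity of the first summand matters, so the endpoints of `s` are not recorded. -/
theorem Bimod.cls_of_covBy_top {X : Bimod F L} {K : Subbimod X.toWeakBimod} (hK : K ⋖ ⊤) :
    ∃ s : CompositionSeries (Subbimod X.toWeakBimod), X.cls =
      Bimod.seriesClass s + Gr.of (Irr.mk (X.factor K ⊤) (X.factor_isIrreducible hK)) := by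
  obtain ⟨f, f0, n, hn, hf⟩ :=
    exists_covBy_seq_of_wellFoundedLT_wellFoundedGT_of_le (bot_le (a := K))
  let s : CompositionSeries (Subbimod X.toWeakBimod) := ⟨n, fun i => f i, fun i => hf i i.2⟩
  -- The given chain up to index n, where it reaches K, followed by ⊤.
  let g : ℕ → Subbimod X.toWeakBimod := fun i => if i ≤ n then f i else ⊤
  have g1 : ∀ i ≤ n, g i = f i := fun i hi => if_pos hi
  have g2 : g (n + 1) = ⊤ := if_neg (by omega)
  have hgc : ∀ i < n + 1, g i ⋖ g (i + 1) := by
    intro i hi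
    rcases Nat.lt_succ_iff_lt_or_eq.1 hi with hi | rfl
    · rw [g1 i hi.le, g1 (i + 1) hi]; exact hf i hi
    · rw [g1 i le_rfl, g2, hn]; exact hK
  let t : CompositionSeries (Subbimod X.toWeakBimod) := ⟨n + 1, fun i => g i, fun i => hgc i i.2⟩
  refine ⟨s, ?_⟩
  rw [← Bimod.seriesClass_eq_cls t ((g1 0 (Nat.zero_le _)).trans f0) g2]
  -- Factors depend on the subbimodules and on a proof of covering; this lets equal endpoints be
  -- exchanged without casts.
  have key : ∀ (A B A' B' : Subbimod X.toWeakBimod) (h : A ⋖ B) (h' : A' ⋖ B'), A = A' → B = B' →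
      Irr.mk (X.factor A B) (X.factor_isIrreducible h) =
        Irr.mk (X.factor A' B') (X.factor_isIrreducible h') := by
    rintro A B _ _ h h' rfl rfl; rfl
  refine (Fin.sum_univ_castSucc (n := n) _).trans (congrArg₂ (· + ·) ?_ ?_)
  · refine Fintype.sum_congr _ _ fun i => congrArg Gr.of (key _ _ _ _ (t.step _) (s.step i) ?_ ?_)
    · exact g1 i i.2.le
    · exact g1 (i + 1) i.2
  · exact congrArg Gr.of (key _ _ _ _ (t.step (Fin.last n)) hK ((g1 n le_rfl).trans hn) g2)

theorem Bimod.seriesClass_coeff_nonneg {X : Bimod F L}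
    (s : CompositionSeries (Subbimod X.toWeakBimod)) (c : Irr F L) :
    0 ≤ Gr.coeff c (Bimod.seriesClass s) := by
  rw [Bimod.seriesClass, map_sum]
  exact Finset.sum_nonneg fun i _ => Gr.coeff_of_nonneg _ _

/-- An irreducible quotient of `X` occurs in the class of `X`. -/
theorem Bimod.coeff_cls_pos {X Y : Bimod F L} (hY : Y.IsIrreducible)
    (φ : X.carrier →ₗ[F] Y.carrier) (hφ : φ ≠ 0)
    (hl : ∀ (x : L) (m : X.carrier), φ (X.left x m) = Y.left x (φ m))
    (hr : ∀ (x : L) (m : X.carrier), φ (X.right x m) = Y.right x (φ m)) :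
    0 < Gr.coeff (Irr.mk Y hY) X.cls := by
  obtain ⟨s, hs⟩ := Bimod.cls_of_covBy_top (Bimod.ker_covBy_top hY φ hφ hl hr)
  have hmk : Irr.mk _ (X.factor_isIrreducible (Bimod.ker_covBy_top hY φ hφ hl hr)) = Irr.mk Y hY :=
    Irr.mk_eq_mk.2 (Bimod.factor_top_iso φ
      (Bimod.surjective_of_isIrreducible hY φ hφ hl hr) hl hr _ rfl)
  rw [hs, hmk, map_add, Gr.coeff_of_self]
  have := Bimod.seriesClass_coeff_nonneg s (Irr.mk Y hY)
  omega

theorem Bimod.cls_of_isIrreducible {X : Bimod F L} (hX : X.IsIrreducible) :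
    X.cls = Gr.of (Irr.mk X hX) := by
  have h01 : (⊥ : Subbimod X.toWeakBimod) ⋖ ⊤ := by
    refine ⟨lt_top_iff_ne_top.2 fun h => ?_, fun C h1 h2 => ?_⟩
    · have := hX.1
      exact bot_ne_top (α := Submodule F X.carrier) (congrArg Subbimod.toSubmodule h)
    · rcases hX.2 C with h | h
      · exact h1.ne' h
      · exact h2.ne h
  -- The series 0 < X of length 1, whose single factor is X itself.
  let t : CompositionSeries (Subbimod X.toWeakBimod) :=
    ⟨1, fun i => if (i : ℕ) = 0 then ⊥ else ⊤, fun i => by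
      obtain rfl : i = 0 := Subsingleton.elim _ _
      exact h01⟩
  rw [← Bimod.seriesClass_eq_cls t rfl rfl]
  refine (Fin.sum_univ_one _).trans (congrArg Gr.of (Irr.mk_eq_mk.2 ?_))
  exact Bimod.factor_top_iso (X := X) (Y := X) LinearMap.id Function.surjective_id
    (fun _ _ => rfl) (fun _ _ => rfl) ⊥ LinearMap.ker_id.symm

end Classes

/-! ### Symmetric and anti-symmetric bimodules and their products -/

section SymmetricBimodules

variable {F : Type v} {L : Type u} [Field F] [NonUnitalNonAssocRing L] [Module F L]

/-- Symmetric bimodules. -/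
def WeakBimod.IsSymmetric (X : WeakBimod F L) : Prop :=
  ∀ (x : L) (m : X.carrier), X.right x m = -X.left x m

/-- Anti-symmetric bimodules. -/
def WeakBimod.IsAntisymmetric (X : WeakBimod F L) : Prop :=
  ∀ (x : L) (m : X.carrier), X.right x m = 0

/-- Bimodules on which the left action is non-zero. -/
def WeakBimod.ActsNontrivially (X : WeakBimod F L) : Prop :=
  ∃ (x : L) (m : X.carrier), X.left x m ≠ 0

theorem Bimod.factor_isSymmetric {X : Bimod F L} (hX : X.toWeakBimod.IsSymmetric)
    (A B : Subbimod X.toWeakBimod) : (X.factor A B).toWeakBimod.IsSymmetric := by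
  intro x c
  obtain ⟨b, rfl⟩ := Submodule.Quotient.mk_surjective _ c
  exact congrArg (Submodule.Quotient.mk (p := (A.restrict B).toSubmodule)) (Subtype.ext (hX x b.1))

theorem Bimod.factor_isAntisymmetric {X : Bimod F L} (hX : X.toWeakBimod.IsAntisymmetric)
    (A B : Subbimod X.toWeakBimod) : (X.factor A B).toWeakBimod.IsAntisymmetric := by
  intro x c
  obtain ⟨b, rfl⟩ := Submodule.Quotient.mk_surjective _ c
  exact congrArg (Submodule.Quotient.mk (p := (A.restrict B).toSubmodule)) (Subtype.ext (hX x b.1))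

theorem Bimod.truncTensor_isSymmetric {M N : Bimod F L} (hM : M.toWeakBimod.IsSymmetric)
    (hN : N.toWeakBimod.IsSymmetric) : (M.truncTensor N).toWeakBimod.IsSymmetric := by
  intro x c
  obtain ⟨t, rfl⟩ := Submodule.Quotient.mk_surjective _ c
  refine congrArg (Submodule.Quotient.mk
    (p := (truncSub M.toWeakBimod N.toWeakBimod).toSubmodule)) ?_
  change tensorAction M.right N.right x t = -tensorAction M.left N.left x t
  induction t using TensorProduct.induction_on with
  | zero => simp only [map_zero, neg_zero]
  | add s t hs ht => rw [map_add, map_add, hs, ht, neg_add]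
  | tmul m n =>
    rw [tensorAction_tmul, tensorAction_tmul, hM, hN, TensorProduct.neg_tmul,
      TensorProduct.tmul_neg, neg_add]

theorem Bimod.truncTensor_isAntisymmetric {M N : Bimod F L} (hM : M.toWeakBimod.IsAntisymmetric)
    (hN : N.toWeakBimod.IsAntisymmetric) : (M.truncTensor N).toWeakBimod.IsAntisymmetric := by
  intro x c
  obtain ⟨t, rfl⟩ := Submodule.Quotient.mk_surjective _ c
  refine congrArg (Submodule.Quotient.mk
    (p := (truncSub M.toWeakBimod N.toWeakBimod).toSubmodule)) (a₂ := 0) ?_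
  change tensorAction M.right N.right x t = 0
  induction t using TensorProduct.induction_on with
  | zero => rw [map_zero]
  | add s t hs ht => rw [map_add, hs, ht, add_zero]
  | tmul m n =>
    rw [tensorAction_tmul, hM, hN, TensorProduct.zero_tmul, TensorProduct.tmul_zero, add_zero]

theorem truncSub_eq_bot {M N : WeakBimod F L} (h : ∀ t ∈ truncSet M N, t = 0) :
    truncSub M N = ⊥ :=
  le_bot_iff.1 (Subbimod.generated_le fun t ht => h t ht)

/-- Each generator of the truncation contains factors x·m + m·x and x·n + n·x, which vanish here. In
the anti-symmetric case it is the factors m·y and n·y that vanish. -/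
theorem truncSub_eq_bot_of_isSymmetric {M N : WeakBimod F L} (hM : M.IsSymmetric)
    (hN : N.IsSymmetric) : truncSub M N = ⊥ := by
  refine truncSub_eq_bot ?_
  rintro _ ⟨x, y, m, n, rfl⟩
  rw [hM x m, hN x n, add_neg_cancel, add_neg_cancel, TensorProduct.zero_tmul,
    TensorProduct.tmul_zero, add_zero]
  rfl

theorem truncSub_eq_bot_of_isAntisymmetric {M N : WeakBimod F L} (hM : M.IsAntisymmetric)
    (hN : N.IsAntisymmetric) : truncSub M N = ⊥ := by
  refine truncSub_eq_bot ?_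
  rintro _ ⟨x, y, m, n, rfl⟩
  rw [hM y m, hN y n, TensorProduct.zero_tmul, TensorProduct.tmul_zero, add_zero]
  rfl

/-- An irreducible bimodule that is the target of a non-zero equivariant bilinear map on `M × N`
occurs in the class of the truncated tensor product, if nothing is truncated. -/
theorem Bimod.coeff_cls_truncTensor_pos {M N Y : Bimod F L} (hY : Y.IsIrreducible)
    (hT : truncSub M.toWeakBimod N.toWeakBimod = ⊥)
    (β : M.carrier →ₗ[F] N.carrier →ₗ[F] Y.carrier) (hβ : β ≠ 0)
    (hl : ∀ x m n, β (M.left x m) n + β m (N.left x n) = Y.left x (β m n))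
    (hr : ∀ x m n, β (M.right x m) n + β m (N.right x n) = Y.right x (β m n)) :
    0 < Gr.coeff (Irr.mk Y hY) (M.truncTensor N).cls := by
  let T : Submodule F (M.carrier ⊗[F] N.carrier) :=
    (truncSub M.toWeakBimod N.toWeakBimod).toSubmodule
  -- The bilinear map linearises to the tensor product, and descends to the quotient because the
  -- truncation is zero.
  let Φ : M.carrier ⊗[F] N.carrier →ₗ[F] Y.carrier := TensorProduct.lift β
  have hTΦ : T ≤ LinearMap.ker Φ := by
    have : T = ⊥ := congrArg Subbimod.toSubmodule hT
    rw [this]; exact bot_le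
  have hlΦ : ∀ x t, Φ (tensorAction M.left N.left x t) = Y.left x (Φ t) := by
    intro x t
    induction t using TensorProduct.induction_on with
    | zero => simp only [map_zero]
    | add s t hs ht => simp only [map_add, hs, ht]
    | tmul m n => simp only [Φ, tensorAction_tmul, map_add, TensorProduct.lift.tmul, hl]
  have hrΦ : ∀ x t, Φ (tensorAction M.right N.right x t) = Y.right x (Φ t) := by
    intro x t
    induction t using TensorProduct.induction_on with
    | zero => simp only [map_zero]
    | add s t hs ht => simp only [map_add, hs, ht]
    | tmul m n => simp only [Φ, tensorAction_tmul, map_add, TensorProduct.lift.tmul, hr]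
  refine Bimod.coeff_cls_pos (X := M.truncTensor N) hY (T.liftQ Φ hTΦ) (fun h => hβ ?_)
    (fun x c => ?_) (fun x c => ?_)
  · refine LinearMap.ext₂ fun m n => ?_
    exact LinearMap.congr_fun h (T.mkQ (m ⊗ₜ[F] n))
  · obtain ⟨t, rfl⟩ := Submodule.Quotient.mk_surjective T c
    exact hlΦ x t
  · obtain ⟨t, rfl⟩ := Submodule.Quotient.mk_surjective T c
    exact hrΦ x t

/-! ### The trivial bimodule as identity element -/

variable (F L) in
/-- The trivial one-dimensional bimodule. -/
def Bimod.trivial : Bimod F L where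
  carrier := F
  left := 0
  right := 0
  llm := fun x y m => by simp
  lml := fun x y m => by simp
  mll := fun x y m => by simp

theorem Bimod.trivial_isIrreducible : (Bimod.trivial F L).IsIrreducible := by
  refine ⟨inferInstanceAs (Nontrivial F), fun A => ?_⟩
  rcases eq_bot_or_eq_top (α := Submodule F F) A.toSubmodule with h | h
  · exact Or.inl (Subbimod.ext h)
  · exact Or.inr (Subbimod.ext h)

variable (F L) in
/-- The class of the trivial bimodule. -/
def Irr.one : Irr F L := Irr.mk (Bimod.trivial F L) Bimod.trivial_isIrreducible

/-- Both actions on the trivial bimodule are zero, so nothing is truncated and F ⊗ Y ≅ Y respects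
both actions. -/
theorem Irr.one_mul (c : Irr F L) : Irr.mul (Irr.one F L) c = Gr.of c := by
  induction c using Quotient.inductionOn with
  | h Y =>
    obtain ⟨Y, hY⟩ := Y
    refine Eq.trans (Bimod.cls_congr (X := (Bimod.trivial F L).truncTensor Y) (Y := Y) ?_)
      (Bimod.cls_of_isIrreducible hY)
    have hT : truncSub (Bimod.trivial F L).toWeakBimod Y.toWeakBimod = ⊥ := by
      refine truncSub_eq_bot ?_
      rintro _ ⟨x, y, m, n, rfl⟩
      have h : ∀ u v : Y.carrier, ((0 : F) + 0) ⊗ₜ[F] u + (0 : F) ⊗ₜ[F] v = 0 := fun u v => by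
        rw [add_zero, TensorProduct.zero_tmul, TensorProduct.zero_tmul, add_zero]
      exact h _ _
    let T : Submodule F (F ⊗[F] Y.carrier) :=
      (truncSub (Bimod.trivial F L).toWeakBimod Y.toWeakBimod).toSubmodule
    have hl : ∀ x t, TensorProduct.lid F Y.carrier
        (tensorAction (V := F) (0 : L →ₗ[F] Module.End F F) Y.left x t) =
          Y.left x (TensorProduct.lid F Y.carrier t) := by
      intro x t
      induction t using TensorProduct.induction_on with
      | zero => simp only [map_zero]
      | add s t hs ht => simp only [map_add, hs, ht]
      | tmul m n => simp [tensorAction_tmul]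
    have hr : ∀ x t, TensorProduct.lid F Y.carrier
        (tensorAction (V := F) (0 : L →ₗ[F] Module.End F F) Y.right x t) =
          Y.right x (TensorProduct.lid F Y.carrier t) := by
      intro x t
      induction t using TensorProduct.induction_on with
      | zero => simp only [map_zero]
      | add s t hs ht => simp only [map_add, hs, ht]
      | tmul m n => simp [tensorAction_tmul]
    refine ⟨(Submodule.quotEquivOfEqBot T (congrArg Subbimod.toSubmodule hT)).trans
      (TensorProduct.lid F Y.carrier), fun x c => ?_, fun x c => ?_⟩
    · obtain ⟨t, rfl⟩ := Submodule.Quotient.mk_surjective T c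
      exact hl x t
    · obtain ⟨t, rfl⟩ := Submodule.Quotient.mk_surjective T c
      exact hr x t

theorem Gr.one_mul (f : Gr F L) : Gr.of (Irr.one F L) * f = f :=
  Gr.of_mul_of_forall Irr.one_mul f

/-- With zero actions every line is a subbimodule, so irreducibility forces dimension one. -/
theorem Bimod.mk_eq_one {X : Bimod F L} (hX : X.IsIrreducible) (hl : ∀ x m, X.left x m = 0)
    (hr : ∀ x m, X.right x m = 0) : Irr.mk X hX = Irr.one F L := by
  have := hX.1
  obtain ⟨v, hv⟩ := exists_ne (0 : X.carrier)
  have htop : Submodule.span F {v} = ⊤ := by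
    let A : Subbimod X.toWeakBimod :=
      { toSubmodule := Submodule.span F {v}
        left_mem := fun x m _ => by rw [hl]; exact Submodule.zero_mem _
        right_mem := fun x m _ => by rw [hr]; exact Submodule.zero_mem _ }
    rcases hX.2 A with h | h
    · exact absurd (Submodule.span_singleton_eq_bot.1 (congrArg Subbimod.toSubmodule h)) hv
    · exact congrArg Subbimod.toSubmodule h
  let e : F ≃ₗ[F] X.carrier := (LinearEquiv.toSpanNonzeroSingleton F X.carrier v hv).trans
    (LinearEquiv.ofTop _ htop)
  refine (Irr.mk_eq_mk (hX := Bimod.trivial_isIrreducible).2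
    ⟨e, fun x m => ?_, fun x m => ?_⟩).symm
  · rw [hl]; exact map_zero e
  · rw [hr]; exact map_zero e

theorem Bimod.actsNontrivially_of_mk_ne_one {X : Bimod F L} {hX : X.IsIrreducible}
    (h : X.toWeakBimod.IsSymmetric ∨ X.toWeakBimod.IsAntisymmetric)
    (h1 : Irr.mk X hX ≠ Irr.one F L) : X.toWeakBimod.ActsNontrivially := by
  by_contra hn
  have hl : ∀ x m, X.left x m = 0 := by
    simpa only [WeakBimod.ActsNontrivially, not_exists, not_not] using hn
  refine h1 (Bimod.mk_eq_one hX hl fun x m => ?_)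
  rcases h with h | h
  · rw [h, hl, neg_zero]
  · exact h x m

theorem Bimod.mk_ne_one {X : Bimod F L} (hX : X.IsIrreducible)
    (h : X.toWeakBimod.ActsNontrivially) : Irr.mk X hX ≠ Irr.one F L := by
  intro h1
  obtain ⟨e, hl, -⟩ := Irr.mk_eq_mk.1 h1
  obtain ⟨x, m, hm⟩ := h
  exact hm (e.map_eq_zero_iff.1 (hl x m))

/-! ### Vanishing of mixed products -/

/-- The span of L·X is stable under the right action too, since that action is either minus the left
one or zero; it is non-zero, hence everything. -/
theorem Bimod.span_left_eq_top {X : Bimod F L} (hX : X.IsIrreducible)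
    (h : X.toWeakBimod.IsSymmetric ∨ X.toWeakBimod.IsAntisymmetric)
    (hn : X.toWeakBimod.ActsNontrivially) :
    Submodule.span F {v : X.carrier | ∃ x m, v = X.left x m} = ⊤ := by
  let A : Subbimod X.toWeakBimod :=
    { toSubmodule := Submodule.span F {v : X.carrier | ∃ x m, v = X.left x m}
      left_mem := fun x m _ => Submodule.subset_span ⟨x, m, rfl⟩
      right_mem := fun x m _ => by
        rcases h with h | h
        · rw [h]; exact Submodule.neg_mem _ (Submodule.subset_span ⟨x, m, rfl⟩)
        · rw [h]; exact Submodule.zero_mem _ }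
  rcases hX.2 A with h' | h'
  · obtain ⟨x, m, hm⟩ := hn
    refine absurd ?_ hm
    have : X.left x m ∈ A.toSubmodule := Submodule.subset_span ⟨x, m, rfl⟩
    rw [h'] at this
    exact this
  · exact congrArg Subbimod.toSubmodule h'

/-- For M symmetric and N anti-symmetric the generators of the truncation collapse to −(y·m) ⊗
(x·n). They span L·M ⊗ L·N, which is all of M ⊗ N by `Bimod.span_left_eq_top`. -/
theorem Bimod.truncTensor_subsingleton {M N : Bimod F L} (hM : M.IsIrreducible)
    (hN : N.IsIrreducible) (hMs : M.toWeakBimod.IsSymmetric) (hNa : N.toWeakBimod.IsAntisymmetric)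
    (hMn : M.toWeakBimod.ActsNontrivially) (hNn : N.toWeakBimod.ActsNontrivially) :
    Subsingleton (M.truncTensor N).carrier := by
  refine Submodule.Quotient.subsingleton_iff.2 ?_
  let T : Submodule F (M.carrier ⊗[F] N.carrier) :=
    (truncSub M.toWeakBimod N.toWeakBimod).toSubmodule
  have key : ∀ y m x n, M.left y m ⊗ₜ[F] N.left x n ∈ T := by
    intro y m x n
    have : (M.left x m + M.right x m) ⊗ₜ[F] N.right y n +
        M.right y m ⊗ₜ[F] (N.left x n + N.right x n) ∈ T :=
      Subbimod.subset_generated _ _ ⟨x, y, m, n, rfl⟩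
    rw [hMs, hNa, hMs, hNa, TensorProduct.tmul_zero, zero_add, add_zero,
      TensorProduct.neg_tmul] at this
    exact (Submodule.neg_mem_iff T).1 this
  refine ((Submodule.eq_top_iff' (p := T)).2 fun t => ?_ : T = ⊤)
  induction t using TensorProduct.induction_on with
  | zero => exact T.zero_mem
  | add s t hs ht => exact T.add_mem hs ht
  | tmul m n =>
    have hm : m ∈ Submodule.span F {v : M.carrier | ∃ x m, v = M.left x m} := by
      rw [Bimod.span_left_eq_top hM (Or.inl hMs) hMn]; trivial
    have hn : n ∈ Submodule.span F {v : N.carrier | ∃ x m, v = N.left x m} := by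
      rw [Bimod.span_left_eq_top hN (Or.inr hNa) hNn]; trivial
    induction hm using Submodule.span_induction with
    | zero => rw [TensorProduct.zero_tmul]; exact T.zero_mem
    | add a b _ _ ha hb => rw [TensorProduct.add_tmul]; exact T.add_mem ha hb
    | smul c a _ ha => rw [← TensorProduct.smul_tmul']; exact T.smul_mem c ha
    | mem a ha =>
      obtain ⟨y, m, rfl⟩ := ha
      induction hn using Submodule.span_induction with
      | zero => rw [TensorProduct.tmul_zero]; exact T.zero_mem
      | add a b _ _ ha hb => rw [TensorProduct.tmul_add]; exact T.add_mem ha hb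
      | smul c a _ ha => rw [TensorProduct.tmul_smul]; exact T.smul_mem c ha
      | mem a ha =>
        obtain ⟨x, n, rfl⟩ := ha
        exact key y m x n

/-- Classes of symmetric irreducible bimodules. -/
def Irr.IsSymmetric (c : Irr F L) : Prop :=
  ∃ (X : Bimod F L) (hX : X.IsIrreducible), X.toWeakBimod.IsSymmetric ∧ c = Irr.mk X hX

/-- Classes of anti-symmetric irreducible bimodules. -/
def Irr.IsAntisymmetric (c : Irr F L) : Prop :=
  ∃ (X : Bimod F L) (hX : X.IsIrreducible), X.toWeakBimod.IsAntisymmetric ∧ c = Irr.mk X hX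

theorem Irr.mul_eq_zero {c d : Irr F L} (hc : c.IsSymmetric) (hd : d.IsAntisymmetric)
    (hc1 : c ≠ Irr.one F L) (hd1 : d ≠ Irr.one F L) : Irr.mul c d = 0 := by
  obtain ⟨X, hX, hXs, rfl⟩ := hc
  obtain ⟨Y, hY, hYa, rfl⟩ := hd
  exact Bimod.cls_eq_zero_of_subsingleton (Bimod.truncTensor_subsingleton hX hY hXs hYa
    (Bimod.actsNontrivially_of_mk_ne_one (Or.inl hXs) hc1)
    (Bimod.actsNontrivially_of_mk_ne_one (Or.inr hYa) hd1))

theorem Bimod.isSymmetric_of_coeff_cls_ne_zero {X : Bimod F L} (hX : X.toWeakBimod.IsSymmetric)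
    {c : Irr F L} (h : Gr.coeff c X.cls ≠ 0) : c.IsSymmetric := by
  obtain ⟨A, B, hAB, rfl⟩ := Bimod.exists_factor_of_coeff_cls_ne_zero h
  exact ⟨_, _, Bimod.factor_isSymmetric hX A B, rfl⟩

theorem Bimod.isAntisymmetric_of_coeff_cls_ne_zero {X : Bimod F L}
    (hX : X.toWeakBimod.IsAntisymmetric) {c : Irr F L} (h : Gr.coeff c X.cls ≠ 0) :
    c.IsAntisymmetric := by
  obtain ⟨A, B, hAB, rfl⟩ := Bimod.exists_factor_of_coeff_cls_ne_zero h
  exact ⟨_, _, Bimod.factor_isAntisymmetric hX A B, rfl⟩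

/-- The part of an element without multiples of the class of the trivial bimodule. -/
noncomputable def Gr.nontrivialPart (f : Gr F L) : Gr F L :=
  f - Gr.coeff (Irr.one F L) f • Gr.of (Irr.one F L)

theorem Gr.eq_add_nontrivialPart (f : Gr F L) :
    f = Gr.coeff (Irr.one F L) f • Gr.of (Irr.one F L) + f.nontrivialPart := by
  rw [Gr.nontrivialPart, add_sub_cancel]

theorem Gr.coeff_nontrivialPart_of_ne {c : Irr F L} (hc : c ≠ Irr.one F L) (f : Gr F L) :
    Gr.coeff c f.nontrivialPart = Gr.coeff c f := by
  rw [Gr.nontrivialPart, map_sub, map_zsmul, Gr.coeff_of_ne hc, smul_zero, sub_zero]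

theorem Gr.ne_one_of_coeff_nontrivialPart_ne_zero {c : Irr F L} {f : Gr F L}
    (h : Gr.coeff c f.nontrivialPart ≠ 0) : c ≠ Irr.one F L ∧ Gr.coeff c f ≠ 0 := by
  have hc : c ≠ Irr.one F L := by
    rintro rfl
    rw [Gr.nontrivialPart, map_sub, map_zsmul, Gr.coeff_of_self, smul_eq_mul, mul_one,
      sub_self] at h
    exact h rfl
  rw [Gr.coeff_nontrivialPart_of_ne hc] at h
  exact ⟨hc, h⟩

/-- The trivial class is at once symmetric and anti-symmetric, so the vanishing of mixed products
only holds after its multiples have been removed from both factors. -/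
theorem Gr.nontrivialPart_mul_nontrivialPart {f g : Gr F L}
    (hf : ∀ c, Gr.coeff c f ≠ 0 → c.IsSymmetric) (hg : ∀ c, Gr.coeff c g ≠ 0 → c.IsAntisymmetric) :
    f.nontrivialPart * g.nontrivialPart = 0 := by
  refine Gr.mul_eq_zero_of_forall fun c d hc hd => ?_
  obtain ⟨hc1, hc⟩ := Gr.ne_one_of_coeff_nontrivialPart_ne_zero hc
  obtain ⟨hd1, hd⟩ := Gr.ne_one_of_coeff_nontrivialPart_ne_zero hd
  exact Irr.mul_eq_zero (hf c hc) (hg d hd) hc1 hd1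

theorem Gr.nontrivialPart_of {c : Irr F L} (hc : c ≠ Irr.one F L) :
    (Gr.of c).nontrivialPart = Gr.of c := by
  rw [Gr.nontrivialPart, Gr.coeff_of_ne hc.symm, zero_smul, sub_zero]

theorem Gr.eq_of_coeff_of_ne_zero {c d : Irr F L} (h : Gr.coeff d (Gr.of c) ≠ 0) : d = c := by
  by_contra hd
  exact h (Gr.coeff_of_ne hd)

/-! ### The two ring identities fail -/

/-- The symmetric bimodule of a left module. -/
def Bimod.ofSymm {V : Type v} [AddCommGroup V] [Module F V] [FiniteDimensional F V]
    (ρ : L →ₗ[F] Module.End F V) (hρ : ∀ x y v, ρ (x * y) v = ρ x (ρ y v) - ρ y (ρ x v)) :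
    Bimod F L where
  carrier := V
  left := ρ
  right := -ρ
  llm := hρ
  lml := fun x y m => by
    simp only [LinearMap.neg_apply, map_neg, hρ]
    abel
  mll := fun x y m => by
    simp only [LinearMap.neg_apply, map_neg, neg_neg, hρ]
    abel

/-- The anti-symmetric bimodule of a left module. -/
def Bimod.ofAnti {V : Type v} [AddCommGroup V] [Module F V] [FiniteDimensional F V]
    (ρ : L →ₗ[F] Module.End F V) (hρ : ∀ x y v, ρ (x * y) v = ρ x (ρ y v) - ρ y (ρ x v)) :
    Bimod F L where
  carrier := V
  left := ρ
  right := 0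
  llm := hρ
  lml := fun x y m => by simp
  mll := fun x y m => by simp

/-- A non-trivial irreducible left module with a non-zero invariant bilinear form and a non-zero
equivariant product forces `Gr^bi(L)` to be neither alternative nor Jordan. -/
theorem not_isAlternative_and_not_isCommJordan_of_module {V : Type v} [AddCommGroup V] [Module F V]
    [FiniteDimensional F V] [Nontrivial V] (ρ : L →ₗ[F] Module.End F V)
    (hρ : ∀ x y v, ρ (x * y) v = ρ x (ρ y v) - ρ y (ρ x v))
    (hirr : ∀ p : Submodule F V, (∀ x, ∀ v ∈ p, ρ x v ∈ p) → p = ⊥ ∨ p = ⊤)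
    (hn : ∃ x v, ρ x v ≠ 0)
    (β : V →ₗ[F] V →ₗ[F] F) (hβ0 : β ≠ 0) (hβ : ∀ x v w, β (ρ x v) w + β v (ρ x w) = 0)
    (μ : V →ₗ[F] V →ₗ[F] V) (hμ0 : μ ≠ 0)
    (hμ : ∀ x v w, μ (ρ x v) w + μ v (ρ x w) = ρ x (μ v w)) :
    ¬ IsAlternative (Gr F L) ∧ ¬ IsCommJordan (Gr F L) := by
  let S : Bimod F L := Bimod.ofSymm ρ hρ
  let A : Bimod F L := Bimod.ofAnti ρ hρ
  have hS : S.IsIrreducible := ⟨inferInstanceAs (Nontrivial V), fun B =>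
    (hirr B.toSubmodule B.left_mem).imp Subbimod.ext Subbimod.ext⟩
  have hA : A.IsIrreducible := ⟨inferInstanceAs (Nontrivial V), fun B =>
    (hirr B.toSubmodule B.left_mem).imp Subbimod.ext Subbimod.ext⟩
  have hSs : S.toWeakBimod.IsSymmetric := fun _ _ => rfl
  have hAa : A.toWeakBimod.IsAntisymmetric := fun _ _ => rfl
  have hS1 : Irr.mk S hS ≠ Irr.one F L := Bimod.mk_ne_one hS hn
  have hA1 : Irr.mk A hA ≠ Irr.one F L := Bimod.mk_ne_one hA hn
  set e : Gr F L := Gr.of (Irr.one F L)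
  set s : Gr F L := Gr.of (Irr.mk S hS) with hs
  set a : Gr F L := Gr.of (Irr.mk A hA) with ha
  have hss : s * s = (S.truncTensor S).cls := Gr.of_mul_of _ _
  have haa : a * a = (A.truncTensor A).cls := Gr.of_mul_of _ _
  have hs_symm : ∀ c, Gr.coeff c s ≠ 0 → c.IsSymmetric := fun c hc =>
    ⟨S, hS, hSs, Gr.eq_of_coeff_of_ne_zero hc⟩
  have ha_anti : ∀ c, Gr.coeff c a ≠ 0 → c.IsAntisymmetric := fun c hc =>
    ⟨A, hA, hAa, Gr.eq_of_coeff_of_ne_zero hc⟩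
  have hss_symm : ∀ c, Gr.coeff c (s * s) ≠ 0 → c.IsSymmetric := fun c hc => by
    rw [hss] at hc
    exact Bimod.isSymmetric_of_coeff_cls_ne_zero (Bimod.truncTensor_isSymmetric hSs hSs) hc
  have haa_anti : ∀ c, Gr.coeff c (a * a) ≠ 0 → c.IsAntisymmetric := fun c hc => by
    rw [haa] at hc
    exact Bimod.isAntisymmetric_of_coeff_cls_ne_zero
      (Bimod.truncTensor_isAntisymmetric hAa hAa) hc
  set k : ℤ := Gr.coeff (Irr.one F L) (s * s) with hk
  set l : ℤ := Gr.coeff (Irr.one F L) (a * a) with hl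
  set P : Gr F L := (s * s).nontrivialPart with hP
  set Q : Gr F L := (a * a).nontrivialPart with hQ
  have hβs : ∀ (x : L) (m n : V), β (-ρ x m) n + β m (-ρ x n) = 0 := fun x m n => by
    rw [map_neg, map_neg, LinearMap.neg_apply, ← neg_add, hβ, neg_zero]
  have hβa : ∀ m n : V, β 0 n + β m 0 = 0 := fun m n => by
    rw [map_zero, map_zero, LinearMap.zero_apply, add_zero]
  have hμs : ∀ (x : L) (m n : V), μ (-ρ x m) n + μ m (-ρ x n) = -ρ x (μ m n) := fun x m n => by
    rw [map_neg, map_neg, LinearMap.neg_apply, ← neg_add, hμ]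
  -- The invariant form is an equivariant map to the trivial bimodule, whichever of the two bimodule
  -- structures V carries; hence both k and l are positive.
  have hk0 : k ≠ 0 := by
    rw [hk, hss]
    exact (Bimod.coeff_cls_truncTensor_pos Bimod.trivial_isIrreducible
      (truncSub_eq_bot_of_isSymmetric hSs hSs) β hβ0 hβ hβs).ne'
  have hl0 : l ≠ 0 := by
    rw [hl, haa]
    exact (Bimod.coeff_cls_truncTensor_pos Bimod.trivial_isIrreducible
      (truncSub_eq_bot_of_isAntisymmetric hAa hAa) β hβ0 hβ fun _ => hβa).ne'
  -- The equivariant product shows that s itself occurs in s², and s is not the trivial class.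
  have hP0 : P ≠ 0 := by
    intro h
    have h1 : 0 < Gr.coeff (Irr.mk S hS) (S.truncTensor S).cls :=
      Bimod.coeff_cls_truncTensor_pos hS (truncSub_eq_bot_of_isSymmetric hSs hSs) μ hμ0 hμ
        hμs
    rw [← hss, ← Gr.coeff_nontrivialPart_of_ne hS1, ← hP, h, map_zero] at h1
    exact h1.false
  have hsa : s * a = 0 := by
    have := Gr.nontrivialPart_mul_nontrivialPart hs_symm ha_anti
    rwa [hs, ha, Gr.nontrivialPart_of hS1, Gr.nontrivialPart_of hA1] at this
  have hPa : P * a = 0 := by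
    have := Gr.nontrivialPart_mul_nontrivialPart hss_symm ha_anti
    rwa [ha, Gr.nontrivialPart_of hA1] at this
  have hPQ : P * Q = 0 := Gr.nontrivialPart_mul_nontrivialPart hss_symm haa_anti
  have hssd : s * s = k • e + P := Gr.eq_add_nontrivialPart _
  have haad : a * a = l • e + Q := Gr.eq_add_nontrivialPart _
  have he : ∀ f : Gr F L, e * f = f := Gr.one_mul
  have hssa : (s * s) * a = k • a := by
    rw [hssd, add_mul, smul_mul_assoc, he, hPa, add_zero]
  constructor
  · intro halt
    have h := halt.1 s a
    rw [hssa, hsa, mul_zero] at h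
    exact Gr.of_ne_zero _ (Gr.eq_zero_of_zsmul_eq_zero hk0 h)
  · intro hJ
    have has : a * s = 0 := by rw [mul_comm, hsa]
    -- Both x = a + s and x = a − s satisfy xa = a² and x² = a² + s². Adding the two instances
    -- cancels the term s(a(a² + s²)), which need not vanish; subtracting twice the instance `h0`
    -- for x = a then leaves 2 a²s² = 2 a(a s²).
    have h1 := hJ.lmul_comm_rmul_rmul (a + s) a
    have h2 := hJ.lmul_comm_rmul_rmul (a - s) a
    have e1 : (a + s) * a = a * a := by rw [add_mul, hsa, add_zero]
    have e2 : (a - s) * a = a * a := by rw [sub_mul, hsa, sub_zero]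
    have e3 : (a + s) * (a + s) = a * a + s * s := by
      rw [mul_add, e1, add_mul, has, zero_add]
    have e4 : (a - s) * (a - s) = a * a + s * s := by
      rw [mul_sub, e2, sub_mul, has, zero_sub, sub_neg_eq_add]
    have h0 := hJ.lmul_comm_rmul_rmul a a
    rw [e1, e3, add_mul a s] at h1
    rw [e2, e4, sub_mul a s] at h2
    have e5 : a * (a * (s * s)) = k • (a * a) := by
      rw [mul_comm a (s * s), hssa, mul_smul_comm]
    have e6 : (a * a) * (s * s) = k • (a * a) + l • P := by
      rw [hssd, mul_add, mul_smul_comm, mul_comm (a * a) e, he]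
      rw [mul_comm _ P]
      -- Only the a² multiplied by P is expanded; the other stays, to match k a² on the right.
      nth_rewrite 2 [haad]
      rw [mul_add, hPQ, add_zero, mul_smul_comm, mul_comm P e, he]
    have h3 : (2 * l) • P = 0 := by
      have h12 := congrArg₂ (· + ·) h1 h2
      simp only [mul_add (a * a), mul_add a, h0, e5, e6] at h12
      rw [mul_smul, two_smul]
      rw [add_add_sub_cancel] at h12
      have := sub_eq_zero.2 h12
      refine Eq.trans ?_ this
      abel
    exact hP0 (Gr.eq_zero_of_zsmul_eq_zero (mul_ne_zero two_ne_zero hl0) h3)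

end SymmetricBimodules

/-! ### The canonical Lie algebra of a semi-simple Leibniz algebra -/

section CanonicalLie

variable {F : Type v} {L : Type u} [Field F] [NonUnitalNonAssocRing L] [Module F L]

theorem mul_self_mem_leibnizKernel (x : L) : x * x ∈ leibnizKernel F L :=
  Submodule.subset_span ⟨x, rfl⟩

variable [IsScalarTower F L L] [IsLeftLeibniz L]

/-- The Leibniz identity with equal first two arguments, x(xy) = (xx)y + x(xy), makes squares
annihilate everything from the left. -/
theorem leibnizKernel_mul {z : L} (hz : z ∈ leibnizKernel F L) (y : L) : z * y = 0 := by
  induction hz using Submodule.span_induction with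
  | zero => exact zero_mul y
  | add a b _ _ ha hb => rw [add_mul, ha, hb, add_zero]
  | smul c a _ ha => rw [smul_mul_assoc, ha, smul_zero]
  | mem a ha =>
    obtain ⟨x, rfl⟩ := ha
    have := IsLeftLeibniz.leibniz x x y
    exact left_eq_add.1 (this.trans (add_comm _ _))

theorem mul_mem_leibnizKernel (x : L) {z : L} (hz : z ∈ leibnizKernel F L) :
    x * z ∈ leibnizKernel F L := by
  -- Since zx = zz = 0, the square of x + z is x² + xz.
  have h := mul_self_mem_leibnizKernel (F := F) (x + z)
  rw [mul_add, add_mul, add_mul, leibnizKernel_mul hz, leibnizKernel_mul hz, add_zero,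
    add_zero] at h
  exact ((leibnizKernel F L).add_mem_iff_right (mul_self_mem_leibnizKernel x)).1 h

/-- If the kernel were the whole algebra, all products would vanish; then there would be no non-zero
squares and the kernel would be zero, contradicting that L is non-zero. -/
theorem canonicalLie.nontrivial [Nontrivial L] : Nontrivial (canonicalLie F L) := by
  refine Submodule.Quotient.nontrivial_iff.2 fun h => ?_
  have hmul : ∀ x y : L, x * y = 0 := fun x y =>
    leibnizKernel_mul (F := F) (by rw [h]; trivial) y
  have hbot : leibnizKernel F L = ⊥ := by
    refine eq_bot_iff.2 (Submodule.span_le.2 ?_)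
    rintro _ ⟨x, rfl⟩
    exact hmul x x
  exact bot_ne_top (hbot.symm.trans h)

variable [SMulCommClass F L L]

variable (F L) in
/-- The product of the canonical Lie algebra. -/
def canonicalLie.mulHom : canonicalLie F L →ₗ[F] Module.End F (canonicalLie F L) :=
  (leibnizKernel F L).liftQ
    { toFun := fun x => (leibnizKernel F L).mapQ (leibnizKernel F L) (LinearMap.mulLeft F x)
        fun _ => mul_mem_leibnizKernel x
      map_add' := fun x y => by
        refine Submodule.linearMap_qext _ (LinearMap.ext fun z => ?_)
        exact congrArg (leibnizKernel F L).mkQ (add_mul x y z)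
      map_smul' := fun c x => by
        refine Submodule.linearMap_qext _ (LinearMap.ext fun z => ?_)
        exact congrArg (leibnizKernel F L).mkQ (smul_mul_assoc c x z) }
    fun x hx => by
      refine Submodule.linearMap_qext _ (LinearMap.ext fun z => ?_)
      exact congrArg (leibnizKernel F L).mkQ (leibnizKernel_mul hx z)

instance : LieRing (canonicalLie F L) where
  bracket x y := canonicalLie.mulHom F L x y
  add_lie x y z := by
    change canonicalLie.mulHom F L (x + y) z = _
    rw [map_add]; rfl
  lie_add x y z := map_add (canonicalLie.mulHom F L x) y z
  lie_self x := by
    obtain ⟨x, rfl⟩ := Submodule.Quotient.mk_surjective _ x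
    exact (Submodule.Quotient.mk_eq_zero _).2 (mul_self_mem_leibnizKernel x)
  leibniz_lie x y z := by
    obtain ⟨x, rfl⟩ := Submodule.Quotient.mk_surjective _ x
    obtain ⟨y, rfl⟩ := Submodule.Quotient.mk_surjective _ y
    obtain ⟨z, rfl⟩ := Submodule.Quotient.mk_surjective _ z
    exact congrArg (leibnizKernel F L).mkQ (IsLeftLeibniz.leibniz x y z)

instance : LieAlgebra F (canonicalLie F L) where
  lie_smul c x y := map_smul (canonicalLie.mulHom F L x) c y

/-- The preimage of a solvable ideal is again solvable, so it lies in the Leibniz kernel and the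
ideal is zero. -/
theorem canonicalLie.hasTrivialRadical (hss : IsSemisimpleLeibniz F L) :
    LieAlgebra.HasTrivialRadical F (canonicalLie F L) := by
  refine LieAlgebra.hasTrivialRadical_of_no_solvable_ideals fun I hI => ?_
  obtain ⟨k, hk⟩ := (LieAlgebra.isSolvable_iff F I).1 hI
  rw [LieIdeal.derivedSeries_eq_bot_iff] at hk
  let J : Submodule F L := I.toSubmodule.comap (leibnizKernel F L).mkQ
  have hJ : IsIdeal J := fun x y hy =>
    ⟨lie_mem_right F _ I ((leibnizKernel F L).mkQ x) _ hy,
      lie_mem_left F _ I _ ((leibnizKernel F L).mkQ x) hy⟩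
  have hD : ∀ n, derivedSeries J n ≤
      (LieAlgebra.derivedSeriesOfIdeal F (canonicalLie F L) n I).toSubmodule.comap
        (leibnizKernel F L).mkQ := by
    intro n
    induction n with
    | zero => exact le_rfl
    | succ n ih =>
      refine Submodule.span_le.2 ?_
      rintro _ ⟨x, hx, y, hy, rfl⟩
      rw [LieAlgebra.derivedSeriesOfIdeal_succ]
      exact LieSubmodule.lie_mem_lie (ih hx) (ih hy)
  have hk' : derivedSeries J k ≤ leibnizKernel F L := by
    refine (hD k).trans ?_
    rw [hk]
    intro x hx
    exact (Submodule.Quotient.mk_eq_zero _).1 hx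
  have hsolv : IsSolvableSubspace J := by
    -- After k steps the derived series lies in the Leibniz kernel; as the kernel multiplies to zero
    -- from the left, one more step ends it.
    refine ⟨k + 1, eq_bot_iff.2 (Submodule.span_le.2 ?_)⟩
    rintro _ ⟨x, hx, y, -, rfl⟩
    exact leibnizKernel_mul (hk' hx) y
  have hle := hss J hJ hsolv
  refine eq_bot_iff.2 fun x hx => ?_
  obtain ⟨x, rfl⟩ := Submodule.Quotient.mk_surjective _ x
  exact (Submodule.Quotient.mk_eq_zero _).2 (hle hx)

end CanonicalLie

end LeibnizAlg

/-! ### The adjoint module on a minimal ideal -/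

theorem theorem4p16 {F : Type v} {L : Type u} [Field F] [CharZero F]
    [NonUnitalNonAssocRing L] [Module F L] [IsScalarTower F L L] [SMulCommClass F L L]
    [LeibnizAlg.IsLeftLeibniz L] [Nontrivial L]
    (hss : LeibnizAlg.IsSemisimpleLeibniz F L)
    (hfd : FiniteDimensional F (LeibnizAlg.canonicalLie F L)) :
    ¬ LeibnizAlg.IsAlternative (LeibnizAlg.Gr F L) ∧ ¬ IsCommJordan (LeibnizAlg.Gr F L) := by
  have htr := LeibnizAlg.canonicalLie.hasTrivialRadical hss
  have hnt : Nontrivial (LeibnizAlg.canonicalLie F L) := LeibnizAlg.canonicalLie.nontrivial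
  let g := LeibnizAlg.canonicalLie F L
  let π : L →ₗ[F] g := (LeibnizAlg.leibnizKernel F L).mkQ
  have hπ : Function.Surjective π := Submodule.mkQ_surjective _
  obtain ⟨I, hI, -⟩ := (eq_bot_or_exists_atom_le (⊤ : LieIdeal F g)).resolve_left top_ne_bot
  have hnab : ¬ LieAlgebra.IsSolvable I := fun h =>
    hI.1 ((LieAlgebra.hasTrivialRadical_iff_no_solvable_ideals F _).1 htr I h)
  -- Cartan's criterion: if the Killing form of g vanished on I × I, hence on I × [I, I], then I
  -- would be solvable.
  have hIB : ∃ x ∈ I, ∃ y ∈ I, killingForm F g x y ≠ 0 := by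
    by_contra! h
    exact hnab (LieIdeal.isSolvable_of_killingForm_apply_lie_eq_zero I fun x hx y hy =>
      h x hx y (LieSubmodule.lie_le_right I I hy))
  have hIμ : ∃ x y : I, ⁅x, y⁆ ≠ 0 := by
    by_contra! h
    have : IsLieAbelian I := ⟨h⟩
    exact hnab inferInstance
  -- Bimodule carriers live in the universe of F, while I lives in that of L, so the module is
  -- transported to coordinates.
  let e : I ≃ₗ[F] (Fin (Module.finrank F I) → F) := (Module.finBasis F I).equivFun
  let ρ : L →ₗ[F] Module.End F (Fin (Module.finrank F I) → F) :=
    (e.conj : Module.End F I →ₗ[F] _).comp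
      ((LieModule.toEnd F g I : g →ₗ[F] Module.End F I).comp π)
  have hρ : ∀ x v, ρ x v = e ⁅π x, e.symm v⁆ := fun x v => rfl
  let β := (killingForm F g).compl₁₂ (I.toSubmodule.subtype.comp e.symm.toLinearMap)
    (I.toSubmodule.subtype.comp e.symm.toLinearMap)
  let μ : (Fin (Module.finrank F I) → F) →ₗ[F] (Fin (Module.finrank F I) → F) →ₗ[F]
      (Fin (Module.finrank F I) → F) :=
    ((LieModule.toEnd F I I : I →ₗ[F] Module.End F I).compl₁₂ e.symm.toLinearMap
      e.symm.toLinearMap).compr₂ e.toLinearMap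
  have hβ : ∀ v w, β v w = killingForm F g (e.symm v) (e.symm w) := fun v w => rfl
  have hμ : ∀ v w, μ v w = e ⁅e.symm v, e.symm w⁆ := fun v w => rfl
  have : Nontrivial I := (LieSubmodule.nontrivial_iff_ne_bot F g g).2 hI.1
  have : Nontrivial (Fin (Module.finrank F I) → F) := e.symm.toEquiv.nontrivial
  refine LeibnizAlg.not_isAlternative_and_not_isCommJordan_of_module ρ (fun x y v => ?_)
    (fun p hp => ?_) ?_ β ?_ (fun x v w => ?_) μ ?_ (fun x v w => ?_)
  · rw [hρ, hρ, hρ, hρ, hρ, e.symm_apply_apply, e.symm_apply_apply, ← map_sub, ← lie_lie]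
    rfl
  -- As π is surjective, an L-stable subspace of I is an ideal of g, and minimality of I gives
  -- irreducibility.
  · let J : LieIdeal F g :=
      { toSubmodule := (p.comap e.toLinearMap).map I.toSubmodule.subtype
        lie_mem := by
          rintro z _ ⟨m, hm, rfl⟩
          obtain ⟨x, rfl⟩ := hπ z
          let m' : I := m
          let n : I := ⁅π x, m'⁆
          refine ⟨n, ?_, rfl⟩
          have h : e n ∈ p := by
            have := hp x (e m') hm
            rwa [hρ, e.symm_apply_apply] at this
          exact h }
    have hJI : J ≤ I := by
      rintro _ ⟨m, -, rfl⟩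
      exact m.2
    rcases hI.le_iff.1 hJI with h | h
    · left
      refine eq_bot_iff.2 fun v hv => ?_
      have : ((e.symm v : I) : g) ∈ J := ⟨e.symm v, by simpa using hv, rfl⟩
      rw [h, LieSubmodule.mem_bot] at this
      have h0 : e.symm v = 0 := Subtype.ext this
      exact e.symm.map_eq_zero_iff.1 h0
    · right
      refine eq_top_iff.2 fun v _ => ?_
      have : ((e.symm v : I) : g) ∈ J := by rw [h]; exact (e.symm v).2
      obtain ⟨m, hm, hmv⟩ := this
      obtain rfl : m = e.symm v := Subtype.ext hmv
      simpa using hm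
  · obtain ⟨x, y, hxy⟩ := hIμ
    obtain ⟨z, hz⟩ := hπ x
    refine ⟨z, e y, fun h => hxy ?_⟩
    rw [hρ, e.symm_apply_apply, hz] at h
    exact e.map_eq_zero_iff.1 h
  · intro h
    obtain ⟨x, hx, y, hy, hxy⟩ := hIB
    refine hxy ?_
    have := LinearMap.congr_fun₂ h (e ⟨x, hx⟩) (e ⟨y, hy⟩)
    rwa [hβ, e.symm_apply_apply, e.symm_apply_apply] at this
  · rw [hβ, hβ, hρ, hρ, e.symm_apply_apply, e.symm_apply_apply]
    exact eq_neg_iff_add_eq_zero.1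
      (LieModule.traceForm_apply_lie_apply' F g g (π x) (e.symm v : I) (e.symm w : I))
  · intro h
    obtain ⟨x, y, hxy⟩ := hIμ
    refine hxy ?_
    have := LinearMap.congr_fun₂ h (e x) (e y)
    rw [hμ, e.symm_apply_apply, e.symm_apply_apply] at this
    exact e.map_eq_zero_iff.1 this
  · rw [hμ, hμ, hμ, hρ, hρ, hρ, e.symm_apply_apply, e.symm_apply_apply, e.symm_apply_apply,
      ← map_add]
    refine congrArg e (Subtype.ext ?_)
    -- The bracket of I is equivariant by the Jacobi identity.
    exact (leibniz_lie (π x) ((e.symm v : I) : g) ((e.symm w : I) : g)).symm
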